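/- A family $\mathcal F$ of subsets of a finite set $V$, with core $Y=\bigcap\mathcal F$, is a *$(p,\varepsilon)$-robust sunflower* if $Y\notin\mathcal F$ and $$\Pr_{W\subseteq_p V}\bigl[\exists F\in\mathcal F:\ F\subseteq W\cup Y\bigr]>1-\varepsilon,$$ where $W$ contains each element of $V$ independently with probability $p$. A real number $B>0$ is called a *robust-sunflower constant* if for all $p,\varepsilon\in(0,1/2]$ and all integers $\ell\ge 1$, every family $\mathcal F$ of $\ell$-element subsets of a finite set with $|\mathcal F|\ge\bigl(B\log(\ell/\varepsilon)/p\bigr)^{\ell}$ contains a $(p,\varepsilon)$-robust sunflower $\mathcal F'\subseteq\mathcal F$. Here $\log$ is the natural logarithm. For a prime $n$ and positive integers $c<k<n$, the *Harnik–Raz function* $f_{\mathrm{HR}}^{(c,k)}$ is the monotone Boolean function of the $n$ variables $x_j$, $j\in\mathbb F_n$, given by $$f_{\mathrm{HR}}^{(c,k)}(x)=\bigvee_{S\in\mathcal S}\ \bigwedge_{j\in S}x_j,\qquad \mathcal S=\bigl\{S_P:\ P\in\mathbb F_n[t],\ \deg P\le c-1,\ |S_P|\ge k/2\bigr\},\quad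 S_P=\{P(1),\dots,P(k)\}$$ (the zero polynomial is included among the $P$). A *monotone circuit* is a Boolean circuit with AND and OR gates of fan-in two, whose inputs are variables (and possibly the constants $0,1$); its size is its number of gates. **Theorem.** Robust-sunflower constants exist. Let $B$ be any robust-sunflower constant, and for prime $n$ let $$k=\lfloor n^{1/2}\rfloor,\qquad c=\Bigl\lfloor\frac{k}{18B\log n}\Bigr\rfloor .$$ Then every monotone circuit computing $f_{\mathrm{HR}}^{(c,k)}$ has size $2^{\Omega(c)}=2^{\Omega(n^{1/2}/\log n)}$. That is, there are $\delta>0$ and $N$, depending only on $B$, such that for every prime $n\ge N$ every monotone circuit computing $f_{\mathrm{HR}}^{(c,k)}$ has size at least $2^{\delta c}$ and at least $2^{\delta n^{1/2}/\log n}$. -/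

import Mathlib

/-! ### Robust sunflowers -/

open Classical in
/-- The probability that a `p`-random subset `W` of the finite set `α` (each element is in `W`
independently with probability `p`) satisfies `E`. -/
noncomputable def biasedProb {α : Type} [Fintype α] (p : ℝ) (E : Finset α → Prop) : ℝ :=
  ∑ W : Finset α with E W, p ^ W.card * (1 - p) ^ (Fintype.card α - W.card)

/-- The core `⋂ 𝓕` of a family of subsets of `α`. -/
def familyCore {α : Type} [Fintype α] [DecidableEq α] (𝓕 : Finset (Finset α)) : Finset α :=
  Finset.univ.filter fun x => ∀ F ∈ 𝓕, x ∈ F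

/-- `𝓕` is a `(p, ε)`-robust sunflower: a `p`-random set together with the core `Y = ⋂ 𝓕`
contains a member of `𝓕` with probability greater than `1 - ε`, and `Y` is not itself a member
of `𝓕` (without this, every one-element family would qualify). -/
def IsRobustSunflower {α : Type} [Fintype α] [DecidableEq α] (p ε : ℝ)
    (𝓕 : Finset (Finset α)) : Prop :=
  familyCore 𝓕 ∉ 𝓕 ∧
    1 - ε < biasedProb p (fun W => ∃ F ∈ 𝓕, F ⊆ W ∪ familyCore 𝓕)

/-- `B > 0` is a constant for the robust sunflower theorem: for all `p, ε ∈ (0, 1/2]` and all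
`ℓ ≥ 1`, every `ℓ`-uniform family of at least `(B log(ℓ/ε)/p)^ℓ` sets contains a
`(p, ε)`-robust sunflower. -/
def IsRobustSunflowerConstant (B : ℝ) : Prop :=
  0 < B ∧
    ∀ (α : Type) [Fintype α] [DecidableEq α] (p ε : ℝ),
      0 < p → p ≤ 1 / 2 → 0 < ε → ε ≤ 1 / 2 →
      ∀ ℓ : ℕ, 1 ≤ ℓ → ∀ 𝓕 : Finset (Finset α),
        (∀ F ∈ 𝓕, F.card = ℓ) →
        (B * Real.log ((ℓ : ℝ) / ε) / p) ^ ℓ ≤ (𝓕.card : ℝ) →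
        ∃ 𝓖 ⊆ 𝓕, IsRobustSunflower p ε 𝓖

/-! ### Monotone Boolean circuits -/

/-- What a gate of a circuit over the variables `ι` may read when `m` gates precede it: a variable,
a Boolean constant, or the value of an earlier gate. -/
inductive Wire (ι : Type) (m : ℕ) : Type
  | var (i : ι) : Wire ι m
  | const (b : Bool) : Wire ι m
  | gate (j : Fin m) : Wire ι m

/-- The value on a wire, given the input `x` and the values `v` of the preceding gates. -/
def Wire.eval {ι : Type} {m : ℕ} (x : ι → Bool) (v : Fin m → Bool) : Wire ι m → Bool
  | .var i => x i
  | .const b => b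
  | .gate j => v j

/-- A sequence of `m` gates in topological order, each an AND or an OR of two wires. -/
inductive MonotoneGates (ι : Type) : ℕ → Type
  | nil : MonotoneGates ι 0
  | andGate {m : ℕ} (G : MonotoneGates ι m) (a b : Wire ι m) : MonotoneGates ι (m + 1)
  | orGate {m : ℕ} (G : MonotoneGates ι m) (a b : Wire ι m) : MonotoneGates ι (m + 1)

/-- The values of all gates on the input `x`. -/
def MonotoneGates.eval {ι : Type} (x : ι → Bool) :
    {m : ℕ} → MonotoneGates ι m → (Fin m → Bool)
  | _, .nil => Fin.elim0
  | _, .andGate G a b =>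
      Fin.snoc (α := fun _ => Bool) (G.eval x) (a.eval x (G.eval x) && b.eval x (G.eval x))
  | _, .orGate G a b =>
      Fin.snoc (α := fun _ => Bool) (G.eval x) (a.eval x (G.eval x) || b.eval x (G.eval x))

/-- A monotone Boolean circuit with AND and OR gates of fan-in two and unbounded fan-out, on the
variables `ι`. Its `size` is its number of gates (variables and constants are free). -/
structure MonotoneCircuit (ι : Type) where
  size : ℕ
  gates : MonotoneGates ι size
  output : Wire ι size

/-- The output of a circuit on the input `x`. -/
def MonotoneCircuit.eval {ι : Type} (C : MonotoneCircuit ι) (x : ι → Bool) : Bool :=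
  C.output.eval x (C.gates.eval x)

/-- The circuit `C` computes the Boolean function `f`. -/
def MonotoneCircuit.Computes {ι : Type} (C : MonotoneCircuit ι) (f : (ι → Bool) → Bool) : Prop :=
  ∀ x, C.eval x = f x

/-! ### The Harnik-Raz function -/

open Classical in
/-- The function `D_𝓢 = ⋁_{S ∈ 𝓢} ⋀_{j ∈ S} x_j`. -/
noncomputable def familyDNF {ι : Type} (𝓢 : Set (Finset ι)) (x : ι → Bool) : Bool :=
  decide (∃ S ∈ 𝓢, ∀ j ∈ S, x j = true)

/-- The value set `S_P = {P(1), …, P(k)}`. -/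
def valueSet (n k : ℕ) (P : Polynomial (ZMod n)) : Finset (ZMod n) :=
  (Finset.Icc 1 k).image fun i : ℕ => P.eval (i : ZMod n)

/-- The value sets `S_P` with `|S_P| ≥ k/2`, for polynomials `P` of degree at most `c - 1`
(the zero polynomial included). -/
def harnikRazFamily (n c k : ℕ) : Set (Finset (ZMod n)) :=
  {S | ∃ P : Polynomial (ZMod n), P.degree < (c : WithBot ℕ) ∧
    S = valueSet n k P ∧ (k : ℝ) / 2 ≤ (S.card : ℝ)}

/-- The Harnik-Raz function with parameters `c` and `k`; its `n` variables are indexed by the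
residues modulo `n`. -/
noncomputable def harnikRaz (n c k : ℕ) : (ZMod n → Bool) → Bool :=
  familyDNF (harnikRazFamily n c k)

/-- The choice `k = n^{1/2}`, rounded down. -/
def hrK (n : ℕ) : ℕ := Nat.sqrt n

/-- The choice `c = k / (18 B log n)`, rounded down. -/
noncomputable def hrC (B : ℝ) (n : ℕ) : ℕ := ⌊(hrK n : ℝ) / (18 * B * Real.log n)⌋₊

/-!
The proof has two independent halves.

*Robust-sunflower constants exist* (`isRobustSunflowerConstant_1536`). Passing to the link of a
maximal proper set that lies in exceptionally many members reduces the claim to spread families: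
if at most a fraction `r ^ (-|D|)` of the members contain `D`, for every `D`, then a random set
contains a member with high probability. The random set is exposed as a union of `N ≈ 4 log(ℓ/ε)` independent `q`-random
sets with `q r ≥ 256`. After exposing one of them, `W`, each member `T i` is replaced by the
smallest residue `T j \ W` with `T j ⊆ T i ∪ W`. Residues lie inside the original members, so
spreadness is inherited; and a counting argument that recovers `(W, i)` from the union of `W` with
the residue shows that few residues exceed half of the maximal size
(`sum_biasedWeight_mul_card_large_le`). So every round halves the maximal size with probability at
least `3/4`, and the probability of failure is at most `ℓ (3/4) ^ N` by induction on `N`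
(`biasedProb_not_exists_subset_le`).

*The circuit lower bound* (`two_rpow_le_size`) is Razborov's approximation method, with closed
families of sets in place of sunflower plucking. Negative inputs are uniformly random sets, positive
inputs are the value sets of random polynomials. A family of sets of size at most `c` is closed if
it contains each set `A` whose union with a random set is accepted with probability greater than
`1 - ε`. Closing a family creates few accepted random sets (`exists_isClosedFamily`). By the
robust-sunflower property a closed family has few minimal members of each size
(`card_minimal_le`), and each lies in few value sets (`isSpreadInput_valueSet`); hence removing the
members of size larger than `c / 2` loses few positive inputs (`card_accepts_not_accepts_le`).
Approximating all gates in this way costs a small error per gate, but an approximator of the output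
that accepts the empty set accepts everything, and any other accepts at most half of the positive
inputs (`MonotoneCircuit.accepts_few_or_many`). The Harnik–Raz function accepts most value sets
and rejects most random sets; for the latter, and for `c ≤ k`, the lower bound
`IsRobustSunflowerConstant.one_lt` on the constant is needed.
-/

/-! ### Biased random sets -/

section BiasedSets

variable {α : Type} [Fintype α]

/-- The probability that the `p`-random subset of `α` equals `W`. -/
noncomputable def biasedWeight (p : ℝ) (W : Finset α) : ℝ :=
  p ^ W.card * (1 - p) ^ (Fintype.card α - W.card)

theorem biasedWeight_nonneg {p : ℝ} (h0 : 0 ≤ p) (h1 : p ≤ 1) (W : Finset α) :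
    0 ≤ biasedWeight p W :=
  mul_nonneg (pow_nonneg h0 _) (pow_nonneg (sub_nonneg.2 h1) _)

theorem sum_biasedWeight (p : ℝ) : ∑ W : Finset α, biasedWeight p W = 1 := by
  simp [biasedWeight, Fintype.sum_pow_mul_eq_add_pow]

open Classical in
theorem biasedProb_eq_sum (p : ℝ) (E : Finset α → Prop) :
    biasedProb p E = ∑ W : Finset α, biasedWeight p W * (if E W then 1 else 0) := by
  simp only [biasedProb, biasedWeight, Finset.sum_filter, mul_ite, mul_one, mul_zero]

theorem biasedProb_nonneg {p : ℝ} (h0 : 0 ≤ p) (h1 : p ≤ 1) (E : Finset α → Prop) :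
    0 ≤ biasedProb p E :=
  Finset.sum_nonneg fun W _ => biasedWeight_nonneg h0 h1 W

theorem biasedProb_mono {p : ℝ} (h0 : 0 ≤ p) (h1 : p ≤ 1) {E F : Finset α → Prop}
    (h : ∀ W, E W → F W) : biasedProb p E ≤ biasedProb p F := by
  classical
  refine Finset.sum_le_sum_of_subset_of_nonneg ?_ fun W _ _ => biasedWeight_nonneg h0 h1 W
  intro W hW
  simp only [Finset.mem_filter, Finset.mem_univ, true_and] at hW ⊢
  exact h W hW

theorem biasedProb_or_le {p : ℝ} (h0 : 0 ≤ p) (h1 : p ≤ 1) (E F : Finset α → Prop) :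
    biasedProb p (fun W => E W ∨ F W) ≤ biasedProb p E + biasedProb p F := by
  classical
  rw [biasedProb_eq_sum, biasedProb_eq_sum, biasedProb_eq_sum, ← Finset.sum_add_distrib]
  refine Finset.sum_le_sum fun W _ => ?_
  have := biasedWeight_nonneg h0 h1 W
  by_cases hE : E W <;> by_cases hF : F W <;> simp [hE, hF, this]

theorem biasedProb_add_not (p : ℝ) (E : Finset α → Prop) :
    biasedProb p E + biasedProb p (fun W => ¬ E W) = 1 := by
  classical
  rw [biasedProb_eq_sum, biasedProb_eq_sum, ← Finset.sum_add_distrib]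
  refine (Finset.sum_congr rfl fun W _ => ?_).trans (sum_biasedWeight p)
  by_cases hE : E W <;> simp [hE]

theorem biasedProb_le_one {p : ℝ} (h0 : 0 ≤ p) (h1 : p ≤ 1) (E : Finset α → Prop) :
    biasedProb p E ≤ 1 := by
  linarith [biasedProb_add_not p E, biasedProb_nonneg h0 h1 fun W => ¬ E W]

theorem biasedProb_eq_zero {p : ℝ} {E : Finset α → Prop} (h : ∀ W, ¬ E W) :
    biasedProb p E = 0 := by
  classical
  rw [biasedProb_eq_sum]
  simp [h]

theorem biasedProb_eq_one {p : ℝ} {E : Finset α → Prop} (h : ∀ W, E W) : biasedProb p E = 1 := by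
  have := biasedProb_add_not p E
  rwa [biasedProb_eq_zero (E := fun W => ¬ E W) fun W => not_not.2 (h W), add_zero] at this

theorem biasedProb_exists_le {ι : Type} {p : ℝ} (h0 : 0 ≤ p) (h1 : p ≤ 1) (s : Finset ι)
    (E : ι → Finset α → Prop) :
    biasedProb p (fun W => ∃ i ∈ s, E i W) ≤ ∑ i ∈ s, biasedProb p (E i) := by
  classical
  induction s using Finset.induction_on with
  | empty => simp [biasedProb_eq_zero]
  | insert i s hi ih =>
    rw [Finset.sum_insert hi]
    refine le_trans ?_ (add_le_add_right ih _)
    refine le_trans (biasedProb_mono h0 h1 ?_) (biasedProb_or_le h0 h1 _ _)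
    intro W
    simp

variable [DecidableEq α]

theorem sum_biasedWeight_union_left (b : ℝ) (U : Finset α) (f : Finset α → ℝ) :
    ∑ W : Finset α, biasedWeight b W * f (U ∪ W) =
      ∑ Z : Finset α with U ⊆ Z,
        b ^ (Z.card - U.card) * (1 - b) ^ (Fintype.card α - Z.card) * f Z := by
  have hmaps : ∀ W ∈ (Finset.univ : Finset (Finset α)), U ∪ W ∈ ({Z | U ⊆ Z} : Finset _) := by
    simp
  rw [← Finset.sum_fiberwise_of_maps_to hmaps]
  refine Finset.sum_congr rfl fun Z hZ => ?_
  replace hZ : U ⊆ Z := by simpa using hZ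
  have hfib : ({W | U ∪ W = Z} : Finset (Finset α)) = U.powerset.image (fun X => (Z \ U) ∪ X) := by
    ext W
    simp only [Finset.mem_filter, Finset.mem_univ, true_and, Finset.mem_image, Finset.mem_powerset]
    constructor
    · rintro rfl
      refine ⟨W ∩ U, Finset.inter_subset_right, ?_⟩
      ext x; simp; tauto
    · rintro ⟨X, hX, rfl⟩
      ext x
      have h1 := @hZ x
      have h2 := @hX x
      simp only [Finset.mem_union, Finset.mem_sdiff]; tauto
  have hinj : Set.InjOn (fun X => (Z \ U) ∪ X) (U.powerset : Set (Finset α)) := by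
    intro X hX Y hY hXY
    simp only [Finset.coe_powerset, Set.mem_preimage, Set.mem_powerset_iff, Finset.coe_subset]
      at hX hY
    ext x
    have h1 := @hX x
    have h2 := @hY x
    have h3 : x ∈ (Z \ U) ∪ X ↔ x ∈ (Z \ U) ∪ Y := by
      simp only at hXY
      rw [hXY]
    simp only [Finset.mem_union, Finset.mem_sdiff] at h3; tauto
  rw [hfib, Finset.sum_image hinj]
  have hsum := Finset.sum_pow_mul_eq_add_pow b (1 - b) U
  rw [add_sub_cancel, one_pow] at hsum
  calc _ = ∑ X ∈ U.powerset, (b ^ (Z.card - U.card) * (1 - b) ^ (Fintype.card α - Z.card) * f Z) *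
        (b ^ X.card * (1 - b) ^ (U.card - X.card)) := by
        refine Finset.sum_congr rfl fun X hX => ?_
        rw [Finset.mem_powerset] at hX
        have hdis : Disjoint (Z \ U) X :=
          Finset.disjoint_of_subset_right hX Finset.sdiff_disjoint
        have hU : U ∪ ((Z \ U) ∪ X) = Z := by
          ext x
          have h1 := @hZ x
          have h2 := @hX x
          simp only [Finset.mem_union, Finset.mem_sdiff]; tauto
        have hcZ := Finset.card_le_univ Z
        have hcU := Finset.card_le_card hZ
        have hcX := Finset.card_le_card hX
        rw [hU, biasedWeight, Finset.card_union_of_disjoint hdis, Finset.card_sdiff_of_subset hZ,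
          show Fintype.card α - (Z.card - U.card + X.card) =
            (Fintype.card α - Z.card) + (U.card - X.card) by omega, pow_add, pow_add]
        ring
    _ = _ := by rw [← Finset.mul_sum, hsum, mul_one]

/-- The union of independent `a`- and `b`-random sets is an `(a + b - ab)`-random set. -/
theorem sum_biasedWeight_union (a b : ℝ) (f : Finset α → ℝ) :
    ∑ U : Finset α, biasedWeight a U * ∑ W : Finset α, biasedWeight b W * f (U ∪ W) =
      ∑ Z : Finset α, biasedWeight (a + b - a * b) Z * f Z := by
  simp_rw [sum_biasedWeight_union_left, Finset.mul_sum, Finset.sum_filter]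
  rw [Finset.sum_comm]
  refine Finset.sum_congr rfl fun Z _ => ?_
  rw [← Finset.sum_filter]
  have hpow : ({U | U ⊆ Z} : Finset (Finset α)) = Z.powerset := by ext; simp
  have hsum := Finset.sum_pow_mul_eq_add_pow a ((1 - a) * b) Z
  have hcZ := Finset.card_le_univ Z
  calc _ = ∑ U ∈ Z.powerset, (((1 - a) * (1 - b)) ^ (Fintype.card α - Z.card) * f Z) *
        (a ^ U.card * ((1 - a) * b) ^ (Z.card - U.card)) := by
        rw [hpow]
        refine Finset.sum_congr rfl fun U hU => ?_
        have hcU := Finset.card_le_card (Finset.mem_powerset.1 hU)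
        rw [biasedWeight, show Fintype.card α - U.card =
          (Fintype.card α - Z.card) + (Z.card - U.card) by omega, pow_add, mul_pow, mul_pow]
        ring
    _ = _ := by
        rw [← Finset.mul_sum, hsum, biasedWeight,
          show a + (1 - a) * b = a + b - a * b by ring,
          show (1 - a) * (1 - b) = 1 - (a + b - a * b) by ring]
        ring

theorem sum_biasedWeight_mul_biasedProb (a b : ℝ) (E : Finset α → Prop) :
    ∑ U : Finset α, biasedWeight a U * biasedProb b (fun W => E (U ∪ W)) =
      biasedProb (a + b - a * b) E := by
  classical
  rw [biasedProb_eq_sum, ← sum_biasedWeight_union]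
  simp_rw [biasedProb_eq_sum]

/-- The probability of a monotone event increases with the density of the random set. -/
theorem biasedProb_le_biasedProb {p q : ℝ} (h0 : 0 ≤ p) (hpq : p ≤ q) (h1 : q ≤ 1) (hp1 : p < 1)
    {E : Finset α → Prop} (hE : ∀ U W, U ⊆ W → E U → E W) : biasedProb p E ≤ biasedProb q E := by
  classical
  have hd : 0 < 1 - p := sub_pos.2 hp1
  set b := (q - p) / (1 - p) with hb
  have hb0 : 0 ≤ b := div_nonneg (sub_nonneg.2 hpq) hd.le
  have hb1 : b ≤ 1 := (div_le_one hd).2 (by linarith)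
  have hq : p + b - p * b = q := by
    have : b * (1 - p) = q - p := div_mul_cancel₀ _ hd.ne'
    linarith
  rw [← hq, ← sum_biasedWeight_mul_biasedProb, biasedProb_eq_sum]
  refine Finset.sum_le_sum fun U _ => mul_le_mul_of_nonneg_left ?_ (biasedWeight_nonneg h0 hp1.le U)
  split_ifs with hU
  · have := biasedProb_add_not b (fun W => E (U ∪ W))
    rw [biasedProb_eq_zero (E := fun W => ¬ E (U ∪ W))
      fun W => not_not.2 (hE U _ Finset.subset_union_left hU)] at this
    linarith
  · exact biasedProb_nonneg hb0 hb1 _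

/-- A set `S` lies in a `p`-random set with probability `p ^ |S|`. -/
theorem biasedProb_superset (p : ℝ) (S : Finset α) :
    biasedProb p (fun W => S ⊆ W) = p ^ S.card := by
  classical
  have h := sum_biasedWeight_union_left p S fun _ => (1 : ℝ)
  simp only [mul_one, sum_biasedWeight] at h
  have : biasedProb p (fun W => S ⊆ W) = p ^ S.card * ∑ Z : Finset α with S ⊆ Z,
      p ^ (Z.card - S.card) * (1 - p) ^ (Fintype.card α - Z.card) := by
    rw [Finset.mul_sum, biasedProb]
    refine Finset.sum_congr (by congr) fun Z hZ => ?_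
    replace hZ : S ⊆ Z := by simpa using hZ
    rw [← mul_assoc, ← pow_add, Nat.add_sub_cancel' (Finset.card_le_card hZ)]
  rw [this, ← h, mul_one]

end BiasedSets

/-! ### Spread families are hit by random sets -/

section Spread

variable {α ι : Type} [Fintype α] [DecidableEq α]

theorem biasedWeight_sdiff_le {q : ℝ} (h0 : 0 < q) (h1 : q ≤ 1) {Z D : Finset α} (h : D ⊆ Z) :
    biasedWeight q (Z \ D) ≤ biasedWeight q Z * (1 / q) ^ D.card := by
  have hcD := Finset.card_le_card h
  have hcZ := Finset.card_le_univ Z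
  rw [biasedWeight, biasedWeight, Finset.card_sdiff_of_subset h,
    show Fintype.card α - (Z.card - D.card) = (Fintype.card α - Z.card) + D.card by omega, pow_add]
  have hq : q ^ Z.card = q ^ (Z.card - D.card) * q ^ D.card := by
    rw [← pow_add, Nat.sub_add_cancel hcD]
  rw [hq, show q ^ (Z.card - D.card) * q ^ D.card * (1 - q) ^ (Fintype.card α - Z.card) *
    (1 / q) ^ D.card = q ^ (Z.card - D.card) * (1 - q) ^ (Fintype.card α - Z.card) *
      (q ^ D.card * (1 / q) ^ D.card) by ring, ← mul_pow, mul_one_div_cancel h0.ne', one_pow,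
    mul_one, ← mul_assoc]
  have hs : 0 ≤ 1 - q := by linarith
  exact mul_le_of_le_one_right (by positivity) (pow_le_one₀ hs (by linarith))

/-- The one-round estimate. Write `R W i` for the smallest trace `T j \ W` over all `j` with
`T j ⊆ T i ∪ W`. For a `q`-random set `W`, few of the residues `R W i` have more than half of the
maximal size `ℓ`. The pair `(W, i)` is recovered from `Z = W ∪ R W i`, `D = R W i` and `i`; by
minimality `D` is a subset of every member of the family inside `Z`, hence one of at most `2 ^ ℓ`
sets once `Z` is known, and by spreadness at most `M / r ^ |D|` indices `i` have `D ⊆ T i`. -/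
theorem sum_biasedWeight_mul_card_large_le [DecidableEq ι] {q r M : ℝ} (h0 : 0 < q) (h1 : q ≤ 1)
    (hr : 0 < r) (hqr : 256 ≤ q * r) {ℓ : ℕ} {I : Finset ι} {T : ι → Finset α}
    (hM : 0 ≤ M)
    (hsize : ∀ i ∈ I, (T i).card ≤ ℓ)
    (hspread : ∀ D, (({i ∈ I | D ⊆ T i}.card : ℕ) : ℝ) * r ^ D.card ≤ M)
    {R : Finset α → ι → Finset α}
    (hR : ∀ W, ∀ i ∈ I, ∃ j ∈ I, T j ⊆ T i ∪ W ∧ R W i = T j \ W ∧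
      ∀ j' ∈ I, T j' ⊆ T i ∪ W → (T j \ W).card ≤ (T j' \ W).card) :
    ∑ W : Finset α, biasedWeight q W * (({i ∈ I | ℓ < 2 * (R W i).card}.card : ℕ) : ℝ) ≤
      M * (2 ^ ℓ * (1 / 16) ^ (ℓ + 1)) := by
  classical
  have hRsub : ∀ W, ∀ i ∈ I, R W i ⊆ T i := by
    intro W i hi x hx
    obtain ⟨j, _, hj, hRj, _⟩ := hR W i hi
    rw [hRj, Finset.mem_sdiff] at hx
    exact (Finset.mem_union.1 (hj hx.1)).resolve_right hx.2
  have hRdisj : ∀ W, ∀ i ∈ I, Disjoint W (R W i) := by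
    intro W i hi
    obtain ⟨j, _, hj, hRj, _⟩ := hR W i hi
    rw [hRj]
    exact Finset.disjoint_sdiff
  -- a member of the family inside `Z`, if there is one
  have hJ : ∀ Z : Finset α, ∃ S : Finset α, S.card ≤ ℓ ∧
      ((∃ i ∈ I, T i ⊆ Z) → ∃ i ∈ I, T i ⊆ Z ∧ S = T i) := by
    intro Z
    by_cases h : ∃ i ∈ I, T i ⊆ Z
    · obtain ⟨i, hi, hiZ⟩ := h
      exact ⟨T i, hsize i hi, fun _ => ⟨i, hi, hiZ, rfl⟩⟩
    · exact ⟨∅, by simp, fun h' => absurd h' h⟩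
  choose J hJcard hJ using hJ
  have hRJ : ∀ W, ∀ i ∈ I, R W i ⊆ J (W ∪ R W i) := by
    intro W i hi
    obtain ⟨j, hjI, hj, hRj, hmin⟩ := hR W i hi
    have hZ : T j ⊆ W ∪ R W i := by
      rw [hRj]; intro x hx; simp only [Finset.mem_union, Finset.mem_sdiff]; tauto
    obtain ⟨m, hmI, hmZ, hJm⟩ := hJ (W ∪ R W i) ⟨j, hjI, hZ⟩
    rw [hJm]
    have hmsub : T m ⊆ T i ∪ W := by
      refine hmZ.trans ?_
      rw [Finset.union_comm]
      exact Finset.union_subset_union_left (hRsub W i hi)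
    have hle := hmin m hmI hmsub
    have hsub : T m \ W ⊆ R W i := by
      intro x hx
      rw [Finset.mem_sdiff] at hx
      exact (Finset.mem_union.1 (hmZ hx.1)).resolve_left hx.2
    have heq : T m \ W = R W i := Finset.eq_of_subset_of_card_le hsub (by rw [hRj]; exact hle)
    rw [← heq]
    exact Finset.sdiff_subset
  -- the bad pairs and their codes
  let bad : Finset (Finset α × ι) :=
    {x ∈ Finset.univ ×ˢ I | ℓ < 2 * (R x.1 x.2).card}
  let code : Finset α × ι → (_ : (_ : Finset α) × Finset α) × ι :=
    fun x => ⟨⟨x.1 ∪ R x.1 x.2, R x.1 x.2⟩, x.2⟩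
  let codes : Finset ((_ : (_ : Finset α) × Finset α) × ι) :=
    (Finset.univ.sigma fun Z => {D ∈ (J Z).powerset | D ⊆ Z ∧ ℓ < 2 * D.card}).sigma
      fun y => {i ∈ I | y.2 ⊆ T i}
  have hdecode : ∀ x ∈ bad, (code x).1.1 \ (code x).1.2 = x.1 := by
    intro x hx
    have hx2 : x.2 ∈ I := by
      simp only [bad, Finset.mem_filter, Finset.mem_product] at hx; exact hx.1.2
    exact Finset.union_sdiff_cancel_right (hRdisj _ _ hx2)
  have hinj : Set.InjOn code bad := by
    intro x hx y hy hxy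
    refine Prod.ext ?_ ?_
    · rw [← hdecode x hx, ← hdecode y hy, hxy]
    · have : (code x).2 = (code y).2 := by rw [hxy]
      exact this
  have hcodes : bad.image code ⊆ codes := by
    intro y hy
    obtain ⟨x, hx, rfl⟩ := Finset.mem_image.1 hy
    simp only [bad, Finset.mem_filter, Finset.mem_product, Finset.mem_univ, true_and] at hx
    simp only [codes, code, Finset.mem_sigma, Finset.mem_univ, true_and, Finset.mem_filter,
      Finset.mem_powerset]
    exact ⟨⟨hRJ _ _ hx.1, Finset.subset_union_right, hx.2⟩, hx.1, hRsub _ _ hx.1⟩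
  have hw := fun W : Finset α => biasedWeight_nonneg h0.le h1 W
  have hx0 : 0 ≤ 1 / (q * r) := by positivity
  have hx1 : 1 / (q * r) ≤ 1 / 16 ^ 2 := by
    rw [show (16 : ℝ) ^ 2 = 256 by norm_num]
    exact one_div_le_one_div_of_le (by norm_num) hqr
  calc ∑ W : Finset α, biasedWeight q W * (({i ∈ I | ℓ < 2 * (R W i).card}.card : ℕ) : ℝ)
      = ∑ x ∈ bad, biasedWeight q x.1 := by
        simp only [bad, Finset.sum_filter, Finset.sum_product]
        refine Finset.sum_congr rfl fun W _ => ?_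
        rw [← Finset.sum_filter, Finset.sum_const, nsmul_eq_mul, mul_comm]
    _ = ∑ y ∈ bad.image code, biasedWeight q (y.1.1 \ y.1.2) := by
        rw [Finset.sum_image hinj]
        exact Finset.sum_congr rfl fun x hx => by rw [hdecode x hx]
    _ ≤ ∑ y ∈ codes, biasedWeight q (y.1.1 \ y.1.2) :=
        Finset.sum_le_sum_of_subset_of_nonneg hcodes fun _ _ _ => hw _
    _ = ∑ Z : Finset α, ∑ D ∈ (J Z).powerset with D ⊆ Z ∧ ℓ < 2 * D.card,
          ((({i ∈ I | D ⊆ T i}).card : ℕ) : ℝ) * biasedWeight q (Z \ D) := by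
        simp only [codes, Finset.sum_sigma, Finset.sum_const, nsmul_eq_mul]
    _ ≤ ∑ Z : Finset α, ∑ D ∈ (J Z).powerset with D ⊆ Z ∧ ℓ < 2 * D.card,
          biasedWeight q Z * (M * (1 / 16) ^ (ℓ + 1)) := by
        refine Finset.sum_le_sum fun Z _ => Finset.sum_le_sum fun D hD => ?_
        simp only [Finset.mem_filter] at hD
        have hs : (({i ∈ I | D ⊆ T i}.card : ℕ) : ℝ) ≤ M * (1 / r) ^ D.card := by
          rw [one_div, inv_pow, ← div_eq_mul_inv, le_div_iff₀ (by positivity)]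
          exact hspread D
        have hpow : (1 / (q * r)) ^ D.card ≤ (1 / 16) ^ (ℓ + 1) := by
          calc (1 / (q * r)) ^ D.card ≤ (1 / 16 ^ 2) ^ D.card := pow_le_pow_left₀ hx0 hx1 _
            _ = (1 / 16) ^ (2 * D.card) := by rw [pow_mul]; norm_num
            _ ≤ (1 / 16) ^ (ℓ + 1) :=
              pow_le_pow_of_le_one (by norm_num) (by norm_num) (by omega)
        calc (({i ∈ I | D ⊆ T i}.card : ℕ) : ℝ) * biasedWeight q (Z \ D)
            ≤ (M * (1 / r) ^ D.card) * (biasedWeight q Z * (1 / q) ^ D.card) :=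
              mul_le_mul hs (biasedWeight_sdiff_le h0 h1 hD.2.1) (hw _) (by positivity)
          _ = biasedWeight q Z * (M * (1 / (q * r)) ^ D.card) := by
              rw [show 1 / (q * r) = (1 / q) * (1 / r) by field_simp, mul_pow]; ring
          _ ≤ _ := mul_le_mul_of_nonneg_left (mul_le_mul_of_nonneg_left hpow hM) (hw _)
    _ ≤ ∑ Z : Finset α, biasedWeight q Z * (M * (2 ^ ℓ * (1 / 16) ^ (ℓ + 1))) := by
        refine Finset.sum_le_sum fun Z _ => ?_
        rw [Finset.sum_const, nsmul_eq_mul]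
        have hcard : ((({D ∈ (J Z).powerset | D ⊆ Z ∧ ℓ < 2 * D.card}).card : ℕ) : ℝ) ≤ 2 ^ ℓ := by
          have h2 := (Finset.card_filter_le (J Z).powerset
            fun D => D ⊆ Z ∧ ℓ < 2 * D.card).trans_eq (Finset.card_powerset _)
          exact_mod_cast h2.trans (Nat.pow_le_pow_right (by norm_num) (hJcard Z))
        calc _ ≤ 2 ^ ℓ * (biasedWeight q Z * (M * (1 / 16) ^ (ℓ + 1))) :=
              mul_le_mul_of_nonneg_right hcard (mul_nonneg (hw Z) (by positivity))
          _ = _ := by ring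
    _ = _ := by rw [← Finset.sum_mul, sum_biasedWeight, one_mul]

/-- A spread family of sets of size at most `ℓ` is missed by the union of `N` independent
`q`-random sets with probability at most `ℓ (3/4) ^ N`, once `q r` is a large constant.

With probability at least `3/4` the first random set `U` halves the size bound at a small loss of
members: replace the members by their residues after `U`, which are again spread relative to the
same `M`. Otherwise the family is kept as it is. The lower bound on the number of members is
chosen so that the losses along `ℓ, ⌊ℓ/2⌋, ⌊ℓ/4⌋, …` never exhaust the family. -/
theorem biasedProb_not_exists_subset_le [DecidableEq ι] {q r M : ℝ} (h0 : 0 < q) (h1 : q ≤ 1)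
    (hr : 0 < r) (hqr : 256 ≤ q * r) (hM : 0 < M) (I : Finset ι) (T : ι → Finset α) (N ℓ : ℕ)
    (hsize : ∀ i ∈ I, (T i).card ≤ ℓ)
    (hspread : ∀ D, (({i ∈ I | D ⊆ T i}.card : ℕ) : ℝ) * r ^ D.card ≤ M)
    (hcard : M * (1 - (1 / 2) ^ (ℓ + 1)) ≤ (I.card : ℝ)) :
    biasedProb (1 - (1 - q) ^ N) (fun W : Finset α => ¬ ∃ i ∈ I, T i ⊆ W) ≤
      ℓ * (3 / 4) ^ N := by
  induction N generalizing I T ℓ with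
  | zero =>
    have hpos : 0 < (I.card : ℝ) := by
      refine lt_of_lt_of_le (mul_pos hM (sub_pos.2 ?_)) hcard
      exact pow_lt_one₀ (by norm_num) (by norm_num) (by omega)
    rcases Nat.eq_zero_or_pos ℓ with rfl | hℓ
    · obtain ⟨i, hi⟩ := Finset.card_pos.1 (by exact_mod_cast hpos : 0 < I.card)
      rw [biasedProb_eq_zero]
      · simp
      · intro W hW
        refine hW ⟨i, hi, ?_⟩
        have := Finset.card_eq_zero.1 (Nat.le_zero.1 (hsize i hi))
        rw [this]
        exact Finset.empty_subset W
    · have : (1 : ℝ) ≤ ℓ := by exact_mod_cast hℓ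
      simpa using (biasedProb_le_one (by norm_num) (by norm_num) _).trans this
  | succ N ih =>
    have hp0 : 0 ≤ 1 - (1 - q) ^ N :=
      sub_nonneg.2 (pow_le_one₀ (by linarith) (by linarith))
    have hp1 : 1 - (1 - q) ^ N ≤ 1 := by
      have : 0 ≤ (1 - q) ^ N := pow_nonneg (by linarith) _
      linarith
    rw [show 1 - (1 - q) ^ (N + 1) = q + (1 - (1 - q) ^ N) - q * (1 - (1 - q) ^ N) by ring,
      ← sum_biasedWeight_mul_biasedProb]
    rcases Nat.eq_zero_or_pos ℓ with rfl | hℓ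
    · have h := ih I T 0 hsize hspread hcard
      have hz : ∀ U : Finset α, biasedProb (1 - (1 - q) ^ N)
          (fun W : Finset α => ¬ ∃ i ∈ I, T i ⊆ U ∪ W) ≤ 0 := fun U => by
        refine (biasedProb_mono hp0 hp1 ?_).trans (h.trans (by simp))
        intro W hW hW'
        refine hW ?_
        obtain ⟨i, hi, hiW⟩ := hW'
        exact ⟨i, hi, hiW.trans Finset.subset_union_right⟩
      calc _ ≤ ∑ U : Finset α, biasedWeight q U * 0 := Finset.sum_le_sum fun U _ =>
            mul_le_mul_of_nonneg_left (hz U) (biasedWeight_nonneg h0.le h1 U)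
        _ ≤ _ := by simp
    have hex : ∀ (W : Finset α) (i : ι), ∃ S : Finset α, i ∈ I → ∃ j ∈ I, T j ⊆ T i ∪ W ∧
        S = T j \ W ∧ ∀ j' ∈ I, T j' ⊆ T i ∪ W → (T j \ W).card ≤ (T j' \ W).card := by
      intro W i
      by_cases hi : i ∈ I
      · obtain ⟨j, hj, hmin⟩ := Finset.exists_min_image {j ∈ I | T j ⊆ T i ∪ W}
          (fun j => (T j \ W).card) ⟨i, by simp [hi]⟩
        simp only [Finset.mem_filter] at hj hmin
        exact ⟨T j \ W, fun _ => ⟨j, hj.1, hj.2, rfl, fun j' h1 h2 => hmin j' ⟨h1, h2⟩⟩⟩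
      · exact ⟨∅, fun h => absurd h hi⟩
    choose R hR using hex
    have hround := sum_biasedWeight_mul_card_large_le h0 h1 hr hqr hM.le hsize hspread hR
    -- a round fails if it leaves too many large residues
    let fails : Finset α → Prop := fun U =>
      M * (1 / 2) ^ (ℓ + 1) < (({i ∈ I | ℓ < 2 * (R U i).card}.card : ℕ) : ℝ)
    have hfails : biasedProb q fails ≤ 1 / 4 := by
      classical
      have hlow : biasedProb q fails * (M * (1 / 2) ^ (ℓ + 1)) ≤
          M * (2 ^ ℓ * (1 / 16) ^ (ℓ + 1)) := by
        refine le_trans ?_ hround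
        rw [biasedProb_eq_sum, Finset.sum_mul]
        refine Finset.sum_le_sum fun U _ => ?_
        rw [mul_assoc]
        refine mul_le_mul_of_nonneg_left ?_ (biasedWeight_nonneg h0.le h1 U)
        split_ifs with hU
        · rw [one_mul]; exact hU.le
        · rw [zero_mul]; positivity
      have hc : M * (2 ^ ℓ * (1 / 16) ^ (ℓ + 1)) ≤ (1 / 4) * (M * (1 / 2) ^ (ℓ + 1)) := by
        have : (2 : ℝ) ^ ℓ * (1 / 16) ^ (ℓ + 1) = (1 / 4) ^ ℓ * (1 / 8) * (1 / 2) ^ (ℓ + 1) := by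
          rw [pow_succ, pow_succ, show (1 / 16 : ℝ) = 1 / 2 * (1 / 4) * (1 / 2) by norm_num,
            mul_pow, mul_pow]
          have : (2 : ℝ) ^ ℓ * (1 / 2) ^ ℓ = 1 := by rw [← mul_pow]; norm_num
          linear_combination (1 / 4 : ℝ) ^ ℓ * (1 / 2) ^ ℓ * (1 / 16) * this
        rw [this]
        have h4 : (1 / 4 : ℝ) ^ ℓ ≤ 1 := pow_le_one₀ (by norm_num) (by norm_num)
        have hpos : 0 ≤ M * (1 / 2) ^ (ℓ + 1) := by positivity
        nlinarith
      exact le_of_mul_le_mul_right (hlow.trans hc) (by positivity)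
    have hstep : ∀ U : Finset α, biasedProb (1 - (1 - q) ^ N)
        (fun W : Finset α => ¬ ∃ i ∈ I, T i ⊆ U ∪ W) ≤
        (ℓ : ℝ) / 2 * (3 / 4) ^ N + (open Classical in if fails U then 1 else 0) *
          ((ℓ : ℝ) * (3 / 4) ^ N) := by
      intro U
      by_cases hU : fails U
      · rw [if_pos hU, one_mul]
        have h := ih I T ℓ hsize hspread hcard
        refine le_trans (biasedProb_mono hp0 hp1 ?_)
          (h.trans (le_add_of_nonneg_left (by positivity)))
        intro W hW hW'
        refine hW ?_
        obtain ⟨i, hi, hiW⟩ := hW'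
        exact ⟨i, hi, hiW.trans Finset.subset_union_right⟩
      · rw [if_neg hU, zero_mul, add_zero]
        have hRsub : ∀ i ∈ I, R U i ⊆ T i := by
          intro i hi x hx
          obtain ⟨j, _, hj, hRj, _⟩ := hR U i hi
          rw [hRj, Finset.mem_sdiff] at hx
          exact (Finset.mem_union.1 (hj hx.1)).resolve_right hx.2
        have h := ih {i ∈ I | ¬ ℓ < 2 * (R U i).card} (R U) (ℓ / 2) ?_ ?_ ?_
        · refine le_trans (biasedProb_mono hp0 hp1 ?_) (h.trans ?_)
          · intro W hW hW'
            refine hW ?_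
            obtain ⟨i, hi, hiW⟩ := hW'
            obtain ⟨j, hjI, _, hRj, _⟩ := hR U i (Finset.mem_filter.1 hi).1
            refine ⟨j, hjI, ?_⟩
            rw [hRj] at hiW
            exact sdiff_le_iff.1 hiW
          · exact mul_le_mul_of_nonneg_right Nat.cast_div_le (by positivity)
        · intro i hi
          have := (Finset.mem_filter.1 hi).2
          omega
        · intro D
          refine le_trans (mul_le_mul_of_nonneg_right ?_ (by positivity)) (hspread D)
          refine Nat.cast_le.2 (Finset.card_le_card fun i hi => ?_)
          simp only [Finset.mem_filter] at hi ⊢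
          exact ⟨hi.1.1, hi.2.trans (hRsub i hi.1.1)⟩
        · have hsplit := Finset.card_filter_add_card_filter_not (s := I)
            (fun i => ℓ < 2 * (R U i).card)
          have hsplit' : (({i ∈ I | ℓ < 2 * (R U i).card}.card : ℕ) : ℝ) +
            (({i ∈ I | ¬ ℓ < 2 * (R U i).card}.card : ℕ) : ℝ) = I.card := by exact_mod_cast hsplit
          have hU' := not_lt.1 hU
          have hpow : (1 / 2 : ℝ) ^ ℓ ≤ (1 / 2) ^ (ℓ / 2 + 1) :=
            pow_le_pow_of_le_one (by norm_num) (by norm_num) (by omega)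
          have hpow' : (1 / 2 : ℝ) ^ ℓ = 2 * (1 / 2) ^ (ℓ + 1) := by rw [pow_succ]; ring
          have := mul_le_mul_of_nonneg_left hpow hM.le
          rw [hpow'] at this
          linarith
    classical
    calc _ ≤ ∑ U : Finset α, biasedWeight q U * ((ℓ : ℝ) / 2 * (3 / 4) ^ N +
            (if fails U then 1 else 0) * ((ℓ : ℝ) * (3 / 4) ^ N)) :=
          Finset.sum_le_sum fun U _ => mul_le_mul_of_nonneg_left
            ((hstep U).trans_eq (by congr)) (biasedWeight_nonneg h0.le h1 U)
      _ = (ℓ : ℝ) / 2 * (3 / 4) ^ N + biasedProb q fails * ((ℓ : ℝ) * (3 / 4) ^ N) := by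
          simp_rw [mul_add, Finset.sum_add_distrib, ← mul_assoc]
          rw [biasedProb_eq_sum]
          simp_rw [← Finset.sum_mul]
          rw [sum_biasedWeight]
          ring
      _ ≤ (ℓ : ℝ) / 2 * (3 / 4) ^ N + 1 / 4 * ((ℓ : ℝ) * (3 / 4) ^ N) := by
          have := mul_le_mul_of_nonneg_right hfails
            (by positivity : 0 ≤ (ℓ : ℝ) * (3 / 4) ^ N)
          linarith
      _ = _ := by rw [pow_succ]; ring

end Spread

/-! ### Robust-sunflower constants -/

section Constants

variable {α : Type} [Fintype α] [DecidableEq α]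

/-- A spread uniform family with `r = 1536 log(ℓ/ε) / p` is missed by a `p`-random set with
probability less than `ε`. -/
theorem biasedProb_not_exists_subset_lt {ι : Type} [DecidableEq ι] {p ε : ℝ} (hp : 0 < p)
    (hp2 : p ≤ 1 / 2) (hε : 0 < ε) (hε2 : ε ≤ 1 / 2) {ℓ m : ℕ} (hℓ : 1 ≤ ℓ) (hm : m ≤ ℓ)
    {I : Finset ι} {T : ι → Finset α} (hI : 0 < I.card) (hsize : ∀ i ∈ I, (T i).card ≤ m)
    (hspread : ∀ D, (({i ∈ I | D ⊆ T i}.card : ℕ) : ℝ) *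
      (1536 * Real.log ((ℓ : ℝ) / ε) / p) ^ D.card ≤ I.card) :
    biasedProb p (fun W : Finset α => ¬ ∃ i ∈ I, T i ⊆ W) < ε := by
  have hℓ' : (1 : ℝ) ≤ ℓ := by exact_mod_cast hℓ
  set L := Real.log ((ℓ : ℝ) / ε) with hL
  have hL2 : 1 / 2 ≤ L := by
    have h2 : Real.log 2 ≤ L := by
      refine Real.log_le_log (by norm_num) ?_
      rw [le_div_iff₀ hε]
      linarith
    linarith [Real.log_two_gt_d9]
  set N := ⌊4 * L⌋₊ + 1 with hN
  have hNlow : 4 * L < N := by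
    rw [hN]; push_cast; exact Nat.lt_floor_add_one _
  have hNup : (N : ℝ) ≤ 6 * L := by
    have := Nat.floor_le (by linarith : 0 ≤ 4 * L)
    rw [hN]; push_cast; linarith
  have hN1 : (1 : ℝ) ≤ N := by rw [hN]; push_cast; linarith [Nat.cast_nonneg (α := ℝ) ⌊4 * L⌋₊]
  have hNpos : (0 : ℝ) < N := by linarith
  set q := p / N with hq
  have hq0 : 0 < q := div_pos hp hNpos
  have hqp : q ≤ p := div_le_self hp.le hN1
  have hqr : 256 ≤ q * (1536 * L / p) := by
    rw [hq, show p / N * (1536 * L / p) = 1536 * L / N by field_simp, le_div_iff₀ hNpos]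
    linarith
  have hbern : 1 - p ≤ (1 - q) ^ N := by
    have h := one_add_mul_le_pow (a := -q) (by linarith) N
    have hNq : (N : ℝ) * q = p := by rw [hq]; field_simp
    rw [show 1 + -q = 1 - q by ring] at h
    linarith
  have hI' : (0 : ℝ) < I.card := by exact_mod_cast hI
  have hmain := biasedProb_not_exists_subset_le (N := N) hq0 (by linarith)
    (by positivity : 0 < 1536 * L / p) hqr hI' I T m hsize hspread
    (mul_le_of_le_one_right hI'.le (by linarith [show (0 : ℝ) ≤ (1 / 2) ^ (m + 1) by positivity]))
  have hsub : biasedProb (1 - (1 - q) ^ N) (fun W : Finset α => ∃ i ∈ I, T i ⊆ W) ≤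
      biasedProb p (fun W : Finset α => ∃ i ∈ I, T i ⊆ W) :=
    biasedProb_le_biasedProb (sub_nonneg.2 (pow_le_one₀ (by linarith) (by linarith)))
      (by linarith) (by linarith) (by linarith)
      (fun U W hUW ⟨i, hi, hiU⟩ => ⟨i, hi, hiU.trans hUW⟩)
  have h1 := biasedProb_add_not p (fun W : Finset α => ∃ i ∈ I, T i ⊆ W)
  have h2 := biasedProb_add_not (1 - (1 - q) ^ N) (fun W : Finset α => ∃ i ∈ I, T i ⊆ W)
  have hfinal : (m : ℝ) * (3 / 4) ^ N < ε := by
    have hexp : (3 / 4 : ℝ) ^ N < ε / ℓ := by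
      calc (3 / 4 : ℝ) ^ N ≤ Real.exp (-(1 / 4)) ^ N :=
            pow_le_pow_left₀ (by norm_num) (by linarith [Real.add_one_le_exp (-(1 / 4 : ℝ))]) _
        _ = Real.exp (-(N / 4)) := by rw [← Real.exp_nat_mul]; ring_nf
        _ < Real.exp (-L) := Real.exp_lt_exp.2 (by linarith)
        _ = ε / ℓ := by rw [Real.exp_neg, hL, Real.exp_log (by positivity), inv_div]
    calc (m : ℝ) * (3 / 4) ^ N ≤ ℓ * (3 / 4) ^ N :=
          mul_le_mul_of_nonneg_right (by exact_mod_cast hm) (by positivity)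
      _ < ℓ * (ε / ℓ) := mul_lt_mul_of_pos_left hexp (by linarith)
      _ = ε := by field_simp
  linarith

/-- The core is taken to be a maximal proper `Y` that lies in at least `r ^ (ℓ - |Y|)` members:
maximality makes the link of `Y` spread. -/
theorem isRobustSunflowerConstant_1536 : IsRobustSunflowerConstant 1536 := by
  refine ⟨by norm_num, ?_⟩
  intro α _ _ p ε hp hp2 hε hε2 ℓ hℓ 𝓕 hunif hcard
  set r := 1536 * Real.log ((ℓ : ℝ) / ε) / p with hr
  have hr1 : 1 < r := by
    have hℓ' : (1 : ℝ) ≤ ℓ := by exact_mod_cast hℓ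
    have h2 : Real.log 2 ≤ Real.log ((ℓ : ℝ) / ε) := by
      refine Real.log_le_log (by norm_num) ?_
      rw [le_div_iff₀ hε]
      linarith
    rw [hr, lt_div_iff₀ hp]
    linarith [Real.log_two_gt_d9]
  have hr0 : 0 < r := by linarith
  let heavy : Finset (Finset α) :=
    {Y | Y.card < ℓ ∧ r ^ (ℓ - Y.card) ≤ (({F ∈ 𝓕 | Y ⊆ F}.card : ℕ) : ℝ)}
  have hne : heavy.Nonempty := by
    refine ⟨∅, ?_⟩
    simp only [heavy, Finset.mem_filter, Finset.mem_univ, true_and]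
    refine ⟨by rw [Finset.card_empty]; omega, ?_⟩
    simpa using hcard
  obtain ⟨Y, hY, hmax⟩ := heavy.exists_max_image Finset.card hne
  simp only [heavy, Finset.mem_filter, Finset.mem_univ, true_and] at hY hmax
  obtain ⟨hYℓ, hYr⟩ := hY
  set 𝓖 : Finset (Finset α) := {F ∈ 𝓕 | Y ⊆ F} with h𝓖
  have h𝓖1 : (1 : ℝ) < 𝓖.card := lt_of_lt_of_le (one_lt_pow₀ hr1 (by omega)) hYr
  have h𝓖1' : 1 < 𝓖.card := by exact_mod_cast h𝓖1
  have hYcore : Y ⊆ familyCore 𝓖 := by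
    intro x hx
    simp only [familyCore, Finset.mem_filter, Finset.mem_univ, true_and]
    intro F hF
    exact (Finset.mem_filter.1 hF).2 hx
  refine ⟨𝓖, Finset.filter_subset _ _, ?_, ?_⟩
  · intro hmem
    obtain ⟨F, hF, hne⟩ := Finset.exists_mem_ne h𝓖1' (familyCore 𝓖)
    refine hne (Finset.eq_of_subset_of_card_le ?_ ?_).symm
    · intro x hx
      simp only [familyCore, Finset.mem_filter, Finset.mem_univ, true_and] at hx
      exact hx F hF
    · rw [hunif _ (Finset.mem_filter.1 hF).1, hunif _ (Finset.mem_filter.1 hmem).1]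
  · have hlt := biasedProb_not_exists_subset_lt (I := 𝓖) (T := fun F => F \ Y) (m := ℓ - Y.card)
      hp hp2 hε hε2 hℓ (Nat.sub_le _ _) (by omega) ?_ ?_
    · have h1 := biasedProb_add_not p (fun W : Finset α => ∃ F ∈ 𝓖, F \ Y ⊆ W)
      have h2 : biasedProb p (fun W : Finset α => ∃ F ∈ 𝓖, F \ Y ⊆ W) ≤
          biasedProb p (fun W => ∃ F ∈ 𝓖, F ⊆ W ∪ familyCore 𝓖) := by
        refine biasedProb_mono hp.le (by linarith) ?_
        rintro W ⟨F, hF, hFW⟩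
        refine ⟨F, hF, ?_⟩
        refine (sdiff_le_iff.1 hFW).trans ?_
        rw [sup_comm]
        exact Finset.union_subset_union_right hYcore
      linarith
    · intro F hF
      rw [Finset.card_sdiff_of_subset (Finset.mem_filter.1 hF).2,
        hunif _ (Finset.mem_filter.1 hF).1]
    · intro D
      rw [← hr]
      by_cases hDY : Disjoint D Y
      swap
      · -- the link lives off `Y`
        have : ({F ∈ 𝓖 | D ⊆ F \ Y} : Finset (Finset α)) = ∅ := by
          refine Finset.filter_eq_empty_iff.2 fun F _ hD => hDY ?_
          exact Finset.disjoint_of_subset_left hD Finset.sdiff_disjoint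
        rw [this]; simp
      have hlink : ({F ∈ 𝓖 | D ⊆ F \ Y} : Finset (Finset α)) = {F ∈ 𝓕 | Y ∪ D ⊆ F} := by
        ext F
        simp only [h𝓖, Finset.mem_filter, Finset.subset_sdiff, Finset.union_subset_iff]
        tauto
      have hYD : (Y ∪ D).card = Y.card + D.card := Finset.card_union_of_disjoint hDY.symm
      rw [hlink]
      rcases Finset.eq_empty_or_nonempty D with rfl | hD
      · simp [h𝓖]
      have hDpos := hD.card_pos
      rcases lt_or_ge (Y ∪ D).card ℓ with hlt | hge
      · have hnot : ¬ r ^ (ℓ - (Y ∪ D).card) ≤ (({F ∈ 𝓕 | Y ∪ D ⊆ F}.card : ℕ) : ℝ) := by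
          intro h
          have := hmax (Y ∪ D) ⟨hlt, h⟩
          omega
        calc _ ≤ r ^ (ℓ - (Y ∪ D).card) * r ^ D.card :=
              mul_le_mul_of_nonneg_right (not_le.1 hnot).le (by positivity)
          _ = r ^ (ℓ - Y.card) := by rw [← pow_add]; congr 1; omega
          _ ≤ _ := hYr
      · have hle1 : ({F ∈ 𝓕 | Y ∪ D ⊆ F} : Finset (Finset α)).card ≤ 1 := by
          refine Finset.card_le_one.2 fun F hF F' hF' => ?_
          simp only [Finset.mem_filter] at hF hF'
          rw [← Finset.eq_of_subset_of_card_le hF.2 (by rw [hunif _ hF.1]; exact hge),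
            ← Finset.eq_of_subset_of_card_le hF'.2 (by rw [hunif _ hF'.1]; exact hge)]
        rcases Nat.le_one_iff_eq_zero_or_eq_one.1 hle1 with h0 | h1
        · rw [h0]; simp
        · -- a member contains `Y ∪ D`, so `|Y ∪ D| = ℓ`
          obtain ⟨F, hF⟩ := Finset.card_pos.1 (by omega :
            0 < ({F ∈ 𝓕 | Y ∪ D ⊆ F} : Finset (Finset α)).card)
          simp only [Finset.mem_filter] at hF
          have := (Finset.card_le_card hF.2).trans_eq (hunif _ hF.1)
          rw [h1, Nat.cast_one, one_mul, show D.card = ℓ - Y.card by omega]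
          exact hYr

/-- A robust-sunflower constant is larger than `1 / (2 log 2)`: a family that consists of one
singleton contains no robust sunflower, and it would be large enough for `ℓ = 1` and
`p = ε = 1/2` otherwise. -/
theorem IsRobustSunflowerConstant.one_lt {B : ℝ} (hB : IsRobustSunflowerConstant B) :
    1 < 2 * B * Real.log 2 := by
  by_contra hle
  rw [not_lt] at hle
  obtain ⟨𝓖, h𝓖, hcore, hprob⟩ := hB.2 (Fin 1) (1 / 2) (1 / 2) (by norm_num) le_rfl (by norm_num)
    le_rfl 1 le_rfl {{0}} (by simp) (by
      simp only [pow_one, Nat.cast_one, Finset.card_singleton]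
      rw [show (1 : ℝ) / (1 / 2) = 2 by norm_num]
      linarith)
  rcases Finset.subset_singleton_iff.1 h𝓖 with rfl | rfl
  · rw [biasedProb_eq_zero (by simp)] at hprob
    norm_num at hprob
  · apply hcore
    simp only [familyCore, Finset.mem_singleton]
    ext x
    simp

end Constants

/-! ### Closed families and the approximation method -/

section Approximation

variable {α : Type}

/-- The monotone function `⋁_{F ∈ 𝓐} ⋀_{j ∈ F} x_j` accepts the set `W`. -/
def Accepts (𝓐 : Finset (Finset α)) (W : Finset α) : Prop := ∃ F ∈ 𝓐, F ⊆ W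

theorem Accepts.mono {𝓐 𝓑 : Finset (Finset α)} {W : Finset α} (h : 𝓐 ⊆ 𝓑) (hW : Accepts 𝓐 W) :
    Accepts 𝓑 W :=
  let ⟨F, hF, hFW⟩ := hW
  ⟨F, h hF, hFW⟩

variable [Fintype α] [DecidableEq α]

/-- A family is closed if it contains every set `A` of size at most `c` whose union with a
uniformly random set is accepted with probability greater than `1 - ε`. -/
def IsClosedFamily (ε : ℝ) (c : ℕ) (𝓒 : Finset (Finset α)) : Prop :=
  ∀ A : Finset α, A.card ≤ c → 1 - ε < biasedProb (1 / 2) (fun W => Accepts 𝓒 (W ∪ A)) → A ∈ 𝓒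

/-- The number of subsets of `α` of size at most `c`. -/
def numSmall (α : Type) [Fintype α] (c : ℕ) : ℕ := ({A | A.card ≤ c} : Finset (Finset α)).card

/-- Adding to `𝓕` a set `A` that violates closedness creates a new accepted set `W` only if
`A ⊆ W` and `W = W ∪ A` was rejected, which has probability less than `ε`. -/
theorem exists_isClosedFamily {ε : ℝ} (hε : 0 ≤ ε) (c : ℕ) (𝓕 : Finset (Finset α))
    (h𝓕 : ∀ F ∈ 𝓕, F.card ≤ c) :
    ∃ 𝓒, 𝓕 ⊆ 𝓒 ∧ (∀ F ∈ 𝓒, F.card ≤ c) ∧ IsClosedFamily ε c 𝓒 ∧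
      biasedProb (1 / 2) (fun W => Accepts 𝓒 W ∧ ¬ Accepts 𝓕 W) ≤ numSmall α c * ε := by
  suffices H : ∀ m : ℕ, ∀ 𝓕 : Finset (Finset α), (∀ F ∈ 𝓕, F.card ≤ c) →
      numSmall α c ≤ 𝓕.card + m → ∃ 𝓒, 𝓕 ⊆ 𝓒 ∧ (∀ F ∈ 𝓒, F.card ≤ c) ∧ IsClosedFamily ε c 𝓒 ∧
        biasedProb (1 / 2) (fun W => Accepts 𝓒 W ∧ ¬ Accepts 𝓕 W) ≤ m * ε from
    H _ 𝓕 h𝓕 (by omega)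
  intro m
  induction m with
  | zero =>
    intro 𝓕 h𝓕 hcard
    refine ⟨𝓕, subset_rfl, h𝓕, fun A hA _ => ?_, ?_⟩
    · have : 𝓕 = ({A | A.card ≤ c} : Finset (Finset α)) :=
        Finset.eq_of_subset_of_card_le (fun F hF => by simpa using h𝓕 F hF) hcard
      rw [this]
      simpa using hA
    · rw [biasedProb_eq_zero (by tauto)]
      simp
  | succ m ih =>
    intro 𝓕 h𝓕 hcard
    by_cases hcl : IsClosedFamily ε c 𝓕
    · refine ⟨𝓕, subset_rfl, h𝓕, hcl, ?_⟩
      rw [biasedProb_eq_zero (by tauto)]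
      positivity
    · unfold IsClosedFamily at hcl
      push Not at hcl
      obtain ⟨A, hA, hprob, hA𝓕⟩ := hcl
      obtain ⟨𝓒, hsub, hsize, hclosed, herr⟩ := ih (insert A 𝓕) (by
        intro F hF
        rcases Finset.mem_insert.1 hF with rfl | hF
        exacts [hA, h𝓕 F hF]) (by rw [Finset.card_insert_of_notMem hA𝓕]; omega)
      refine ⟨𝓒, (Finset.subset_insert _ _).trans hsub, hsize, hclosed, ?_⟩
      have hstep : biasedProb (1 / 2) (fun W => Accepts 𝓒 W ∧ ¬ Accepts 𝓕 W) ≤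
          biasedProb (1 / 2) (fun W => (Accepts 𝓒 W ∧ ¬ Accepts (insert A 𝓕) W) ∨
            ¬ Accepts 𝓕 (W ∪ A)) := by
        refine biasedProb_mono (by norm_num) (by norm_num) ?_
        rintro W ⟨h1, h2⟩
        by_cases h3 : Accepts (insert A 𝓕) W
        · obtain ⟨F, hF, hFW⟩ := h3
          rcases Finset.mem_insert.1 hF with rfl | hF
          · right
            rwa [Finset.union_eq_left.2 hFW]
          · exact absurd ⟨F, hF, hFW⟩ h2
        · exact Or.inl ⟨h1, h3⟩
      have hor := biasedProb_or_le (p := 1 / 2) (by norm_num) (by norm_num)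
        (fun W => Accepts 𝓒 W ∧ ¬ Accepts (insert A 𝓕) W) (fun W => ¬ Accepts 𝓕 (W ∪ A))
      have hnot := biasedProb_add_not (1 / 2) (fun W => Accepts 𝓕 (W ∪ A))
      push_cast
      linarith

/-- The core of a robust sunflower among the minimal members of a closed family would belong to
the family and lie strictly below a minimal member. -/
theorem card_minimal_le {B ε : ℝ} (hB : IsRobustSunflowerConstant B) (hε : 0 < ε) (hε2 : ε ≤ 1 / 2)
    {c : ℕ} {𝓒 : Finset (Finset α)} (hclosed : IsClosedFamily ε c 𝓒) {ℓ : ℕ} (hℓ : 1 ≤ ℓ)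
    (hℓc : ℓ ≤ c) :
    (({F ∈ 𝓒 | F.card = ℓ ∧ ∀ G ∈ 𝓒, G ⊆ F → G = F}.card : ℕ) : ℝ) ≤
      (B * Real.log ((ℓ : ℝ) / ε) / (1 / 2)) ^ ℓ := by
  by_contra hlt
  rw [not_le] at hlt
  obtain ⟨𝓖, h𝓖, hcore, hprob⟩ := hB.2 α (1 / 2) ε (by norm_num) le_rfl hε hε2 ℓ hℓ
    {F ∈ 𝓒 | F.card = ℓ ∧ ∀ G ∈ 𝓒, G ⊆ F → G = F} (fun F hF => (Finset.mem_filter.1 hF).2.1) hlt.le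
  rcases 𝓖.eq_empty_or_nonempty with rfl | ⟨F, hF⟩
  · rw [biasedProb_eq_zero (by simp)] at hprob
    linarith
  · have hF' := h𝓖 hF
    simp only [Finset.mem_filter] at hF'
    have hYF : familyCore 𝓖 ⊆ F := by
      intro x hx
      simp only [familyCore, Finset.mem_filter, Finset.mem_univ, true_and] at hx
      exact hx F hF
    have hmem : familyCore 𝓖 ∈ 𝓒 := by
      refine hclosed _ ((Finset.card_le_card hYF).trans (by omega)) (hprob.trans_le ?_)
      refine biasedProb_mono (by norm_num) (by norm_num) ?_
      rintro W ⟨G, hG, hGW⟩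
      exact ⟨G, (Finset.mem_filter.1 (h𝓖 hG)).1, hGW⟩
    rw [hF'.2.2 _ hmem hYF] at hcore
    exact hcore hF

/-- A distribution on positive inputs, given as a map `S` from a finite set of equally likely
outcomes to subsets of `α`, is spread with parameter `κ` up to size `c` if every set `A` of size
at most `c` lies in the input with probability at most `κ ^ |A|`. -/
def IsSpreadInput {Ω : Type} [Fintype Ω] (S : Ω → Finset α) (κ : ℝ) (c : ℕ) : Prop :=
  ∀ A : Finset α, A.card ≤ c →
    (({v | A ⊆ S v} : Finset Ω).card : ℝ) ≤ κ ^ A.card * Fintype.card Ω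

theorem sum_Ioc_one_third_pow_le (a c : ℕ) :
    ∑ ℓ ∈ Finset.Ioc a c, (1 / 3 : ℝ) ^ ℓ ≤ 1 / 2 * (1 / 3) ^ a := by
  rcases le_total c a with h | h
  · rw [Finset.Ioc_eq_empty_of_le h]; simp
  · suffices H : ∑ ℓ ∈ Finset.Ioc a c, (1 / 3 : ℝ) ^ ℓ = 1 / 2 * (1 / 3) ^ a - 1 / 2 * (1 / 3) ^ c by
      rw [H]
      have : (0 : ℝ) ≤ 1 / 2 * (1 / 3) ^ c := by positivity
      linarith
    induction c, h using Nat.le_induction with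
    | base => simp
    | succ c hc ih =>
      rw [← Finset.insert_Ioc_right_eq_Ioc_add_one hc, Finset.sum_insert (by simp), ih, pow_succ]
      ring

open Classical in
/-- Discarding the members of size larger than `a` from a closed family loses few positive
inputs: such an input contains a minimal member of some size `ℓ ∈ (a, c]`, there are at most
`(2 B log(ℓ/ε)) ^ ℓ` of those, and each is contained in a `κ ^ ℓ` fraction of the inputs. -/
theorem card_accepts_not_accepts_le {Ω : Type} [Fintype Ω] {B ε κ : ℝ}
    (hB : IsRobustSunflowerConstant B) (hε : 0 < ε) (hε2 : ε ≤ 1 / 2) {c : ℕ}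
    {𝓒 : Finset (Finset α)} (hsize : ∀ F ∈ 𝓒, F.card ≤ c) (hclosed : IsClosedFamily ε c 𝓒)
    {S : Ω → Finset α} (hκ : 0 ≤ κ) (hS : IsSpreadInput S κ c)
    (hκB : ∀ ℓ : ℕ, 1 ≤ ℓ → ℓ ≤ c → B * Real.log ((ℓ : ℝ) / ε) / (1 / 2) * κ ≤ 1 / 3) (a : ℕ) :
    (({v | Accepts 𝓒 (S v) ∧ ¬ Accepts {F ∈ 𝓒 | F.card ≤ a} (S v)} : Finset Ω).card : ℝ) ≤
      Fintype.card Ω * (1 / 2 * (1 / 3) ^ a) := by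
  let minimal : ℕ → Finset (Finset α) := fun ℓ =>
    {F ∈ 𝓒 | F.card = ℓ ∧ ∀ G ∈ 𝓒, G ⊆ F → G = F}
  have hcover : ({v | Accepts 𝓒 (S v) ∧ ¬ Accepts {F ∈ 𝓒 | F.card ≤ a} (S v)} : Finset Ω) ⊆
      (Finset.Ioc a c).biUnion fun ℓ => (minimal ℓ).biUnion fun F => {v | F ⊆ S v} := by
    intro v hv
    simp only [Finset.mem_filter, Finset.mem_univ, true_and] at hv
    obtain ⟨⟨F, hF, hFv⟩, hnot⟩ := hv
    obtain ⟨G, hG, hmin⟩ := Finset.exists_min_image {F ∈ 𝓒 | F ⊆ S v} Finset.card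
      ⟨F, by simp [hF, hFv]⟩
    simp only [Finset.mem_filter] at hG hmin
    simp only [Finset.mem_biUnion, Finset.mem_Ioc, minimal, Finset.mem_filter, Finset.mem_univ,
      true_and]
    refine ⟨G.card, ⟨?_, hsize G hG.1⟩, G, ⟨hG.1, rfl, fun H hH hHG => ?_⟩, hG.2⟩
    · by_contra hle
      exact hnot ⟨G, by simp [hG.1, not_lt.1 hle], hG.2⟩
    · exact Finset.eq_of_subset_of_card_le hHG (hmin H ⟨hH, hHG.trans hG.2⟩)
  have hΩ : (0 : ℝ) ≤ Fintype.card Ω := Nat.cast_nonneg _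
  calc _ ≤ ∑ ℓ ∈ Finset.Ioc a c, ∑ F ∈ minimal ℓ, (({v | F ⊆ S v} : Finset Ω).card : ℝ) := by
        have h1 := (Finset.card_le_card hcover).trans Finset.card_biUnion_le
        refine (Nat.cast_le.2 h1).trans ?_
        push_cast
        refine Finset.sum_le_sum fun ℓ _ => ?_
        exact_mod_cast Finset.card_biUnion_le
    _ ≤ ∑ ℓ ∈ Finset.Ioc a c, Fintype.card Ω * (1 / 3 : ℝ) ^ ℓ := by
        refine Finset.sum_le_sum fun ℓ hℓ => ?_
        rw [Finset.mem_Ioc] at hℓ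
        have hℓ1 : 1 ≤ ℓ := by omega
        have hlog : 0 ≤ B * Real.log ((ℓ : ℝ) / ε) / (1 / 2) := by
          have : (1 : ℝ) ≤ ℓ := by exact_mod_cast hℓ1
          have := Real.log_nonneg ((one_le_div hε).2 (by linarith) : 1 ≤ (ℓ : ℝ) / ε)
          have := hB.1
          positivity
        calc ∑ F ∈ minimal ℓ, (({v | F ⊆ S v} : Finset Ω).card : ℝ)
            ≤ ∑ F ∈ minimal ℓ, κ ^ ℓ * Fintype.card Ω := by
              refine Finset.sum_le_sum fun F hF => ?_
              simp only [minimal, Finset.mem_filter] at hF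
              rw [← hF.2.1]
              exact hS F (hF.2.1.trans_le hℓ.2)
          _ = (minimal ℓ).card * (κ ^ ℓ * Fintype.card Ω) := by
              rw [Finset.sum_const, nsmul_eq_mul]
          _ ≤ (B * Real.log ((ℓ : ℝ) / ε) / (1 / 2)) ^ ℓ * (κ ^ ℓ * Fintype.card Ω) :=
              mul_le_mul_of_nonneg_right (card_minimal_le hB hε hε2 hclosed hℓ1 hℓ.2)
                (by positivity)
          _ = Fintype.card Ω * (B * Real.log ((ℓ : ℝ) / ε) / (1 / 2) * κ) ^ ℓ := by
              rw [mul_pow]; ring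
          _ ≤ _ := mul_le_mul_of_nonneg_left
              (pow_le_pow_left₀ (by positivity) (hκB ℓ hℓ1 hℓ.2) _) hΩ
    _ ≤ _ := by
        rw [← Finset.mul_sum]
        exact mul_le_mul_of_nonneg_left (sum_Ioc_one_third_pow_le a c) hΩ

end Approximation

/-! ### Approximating a circuit gate by gate -/

section Wires

variable {α : Type}

/-- The family that represents a wire, given families that represent the gates. -/
def Wire.approx {m : ℕ} (𝓐 : Fin m → Finset (Finset α)) : Wire α m → Finset (Finset α)
  | .var i => {{i}}
  | .const true => {∅}
  | .const false => ∅
  | .gate j => 𝓐 j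

theorem Wire.card_le_of_mem_approx {m a : ℕ} (ha : 1 ≤ a) {𝓐 : Fin m → Finset (Finset α)}
    (h : ∀ j, ∀ F ∈ 𝓐 j, F.card ≤ a) (w : Wire α m) : ∀ F ∈ w.approx 𝓐, F.card ≤ a := by
  match w with
  | .var i => simpa [Wire.approx] using ha
  | .const true => simp [Wire.approx]
  | .const false => simp [Wire.approx]
  | .gate j => exact h j

variable [DecidableEq α]

/-- The indicator vector of a set. -/
def inputOf (W : Finset α) : α → Bool := fun i => decide (i ∈ W)

theorem Wire.accepts_approx_of_eval {m : ℕ} {𝓐 : Fin m → Finset (Finset α)} {v : Fin m → Bool}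
    {W : Finset α} (h : ∀ j, v j = true → Accepts (𝓐 j) W) (w : Wire α m)
    (hw : w.eval (inputOf W) v = true) : Accepts (w.approx 𝓐) W := by
  match w with
  | .var i => simpa [Wire.approx, Accepts, Wire.eval, inputOf] using hw
  | .const true => simp [Wire.approx, Accepts]
  | .const false => simp [Wire.eval] at hw
  | .gate j => exact h j hw

theorem Wire.eval_of_accepts_approx {m : ℕ} {𝓐 : Fin m → Finset (Finset α)} {v : Fin m → Bool}
    {W : Finset α} (h : ∀ j, Accepts (𝓐 j) W → v j = true) (w : Wire α m)
    (hw : Accepts (w.approx 𝓐) W) : w.eval (inputOf W) v = true := by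
  match w with
  | .var i => simpa [Wire.approx, Accepts, Wire.eval, inputOf] using hw
  | .const true => rfl
  | .const false => simp [Wire.approx, Accepts] at hw
  | .gate j => exact h j hw

end Wires

section Gates

variable {α Ω : Type} [Fintype α] [DecidableEq α] [Fintype Ω]

open Classical in
/-- The families `𝓐 j`, whose members have size at most `a`, approximate the functions `g · j`:
the outcomes on which some `g · j` exceeds its approximator number at most `P`, and a uniformly
random set is, with probability at most `Q`, accepted by some approximator and rejected by the
corresponding `g · j`. -/
def Approximates (S : Ω → Finset α) (a : ℕ) {m : ℕ} (g : (α → Bool) → Fin m → Bool)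
    (𝓐 : Fin m → Finset (Finset α)) (P Q : ℝ) : Prop :=
  (∀ j, ∀ F ∈ 𝓐 j, F.card ≤ a) ∧
    (({v | ∃ j, g (inputOf (S v)) j = true ∧ ¬ Accepts (𝓐 j) (S v)} : Finset Ω).card : ℝ) ≤ P ∧
    biasedProb (1 / 2) (fun W => ∃ j, Accepts (𝓐 j) W ∧ ¬ g (inputOf W) j = true) ≤ Q

open Classical in
/-- Adding a gate with value `h`: if `𝓕` represents the gate exactly in terms of the approximators
of its inputs, the replacement of `𝓕` by an approximator adds one local error of each kind. -/
theorem Approximates.snoc {S : Ω → Finset α} {a c m : ℕ} {g : (α → Bool) → Fin m → Bool}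
    {𝓐 : Fin m → Finset (Finset α)} {P Q δ η : ℝ}
    (hstep : ∀ 𝓕 : Finset (Finset α), (∀ F ∈ 𝓕, F.card ≤ c) → ∃ 𝓑 : Finset (Finset α),
      (∀ F ∈ 𝓑, F.card ≤ a) ∧
      (({v | Accepts 𝓕 (S v) ∧ ¬ Accepts 𝓑 (S v)} : Finset Ω).card : ℝ) ≤ δ ∧
      biasedProb (1 / 2) (fun W => Accepts 𝓑 W ∧ ¬ Accepts 𝓕 W) ≤ η)
    (h𝓐 : Approximates S a g 𝓐 P Q) {h : (α → Bool) → Bool} {𝓕 : Finset (Finset α)}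
    (h𝓕 : ∀ F ∈ 𝓕, F.card ≤ c)
    (hlow : ∀ W, (∀ j, g (inputOf W) j = true → Accepts (𝓐 j) W) → h (inputOf W) = true →
      Accepts 𝓕 W)
    (hup : ∀ W, (∀ j, Accepts (𝓐 j) W → g (inputOf W) j = true) → Accepts 𝓕 W →
      h (inputOf W) = true) :
    ∃ 𝓐', Approximates S a (fun x => Fin.snoc (α := fun _ => Bool) (g x) (h x)) 𝓐' (P + δ)
      (Q + η) := by
  obtain ⟨hsize, hP, hQ⟩ := h𝓐
  obtain ⟨𝓑, h𝓑, hδ, hη⟩ := hstep 𝓕 h𝓕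
  refine ⟨Fin.snoc (α := fun _ => Finset (Finset α)) 𝓐 𝓑, ?_, ?_, ?_⟩
  · intro j
    refine Fin.lastCases ?_ (fun j => ?_) j
    · rwa [Fin.snoc_last]
    · rw [Fin.snoc_castSucc]; exact hsize j
  · refine le_trans ?_ (add_le_add hP hδ)
    rw [← Nat.cast_add]
    refine Nat.cast_le.2 ((Finset.card_le_card ?_).trans (Finset.card_union_le _ _))
    intro v hv
    simp only [Finset.mem_filter, Finset.mem_univ, true_and, Finset.mem_union] at hv ⊢
    by_contra hno
    push Not at hno
    obtain ⟨j, hj⟩ := hv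
    revert hj
    refine Fin.lastCases ?_ (fun j => ?_) j
    · rw [Fin.snoc_last, Fin.snoc_last]
      exact fun hj => hj.2 (hno.2 (hlow _ hno.1 hj.1))
    · rw [Fin.snoc_castSucc, Fin.snoc_castSucc]
      exact fun hj => hj.2 (hno.1 j hj.1)
  · refine le_trans ?_ (add_le_add hQ hη)
    refine le_trans (biasedProb_mono (by norm_num) (by norm_num) ?_)
      (biasedProb_or_le (by norm_num) (by norm_num) _ _)
    intro W hW
    by_contra hno
    push Not at hno
    obtain ⟨j, hj⟩ := hW
    beta_reduce at hj
    revert hj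
    refine Fin.lastCases ?_ (fun j => ?_) j
    · rw [Fin.snoc_last, Fin.snoc_last]
      exact fun hj => hj.2 (hup _ hno.1 (hno.2 hj.1))
    · rw [Fin.snoc_castSucc, Fin.snoc_castSucc]
      exact fun hj => hj.2 (hno.1 j hj.1)

open Classical in
theorem MonotoneGates.exists_approximates {S : Ω → Finset α} {a c : ℕ} (ha : 1 ≤ a)
    (hac : a + a ≤ c) {δ η : ℝ}
    (hstep : ∀ 𝓕 : Finset (Finset α), (∀ F ∈ 𝓕, F.card ≤ c) → ∃ 𝓑 : Finset (Finset α),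
      (∀ F ∈ 𝓑, F.card ≤ a) ∧
      (({v | Accepts 𝓕 (S v) ∧ ¬ Accepts 𝓑 (S v)} : Finset Ω).card : ℝ) ≤ δ ∧
      biasedProb (1 / 2) (fun W => Accepts 𝓑 W ∧ ¬ Accepts 𝓕 W) ≤ η)
    {m : ℕ} (G : MonotoneGates α m) :
    ∃ 𝓐, Approximates S a (fun x => G.eval x) 𝓐 (m * δ) (m * η) := by
  induction G with
  | nil =>
    refine ⟨Fin.elim0, fun j => j.elim0, ?_, ?_⟩
    · simp
    · rw [biasedProb_eq_zero]
      · simp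
      · rintro W ⟨j, -⟩
        exact j.elim0
  | @andGate m G w₁ w₂ ih =>
    obtain ⟨𝓐, h𝓐⟩ := ih
    have hw := fun w : Wire α m => w.card_le_of_mem_approx ha h𝓐.1
    have := h𝓐.snoc hstep (h := fun x => w₁.eval x (G.eval x) && w₂.eval x (G.eval x))
      (𝓕 := Finset.image₂ (· ∪ ·) (w₁.approx 𝓐) (w₂.approx 𝓐)) ?_ ?_ ?_
    · simpa only [Nat.cast_add, Nat.cast_one, add_mul, one_mul, MonotoneGates.eval] using this
    · intro F hF
      obtain ⟨F₁, h₁, F₂, h₂, rfl⟩ := Finset.mem_image₂.1 hF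
      exact (Finset.card_union_le _ _).trans
        ((add_le_add (hw w₁ _ h₁) (hw w₂ _ h₂)).trans hac)
    · intro W hW hval
      simp only [Bool.and_eq_true] at hval
      obtain ⟨F₁, h₁, hs₁⟩ := w₁.accepts_approx_of_eval hW hval.1
      obtain ⟨F₂, h₂, hs₂⟩ := w₂.accepts_approx_of_eval hW hval.2
      exact ⟨F₁ ∪ F₂, Finset.mem_image₂_of_mem h₁ h₂, Finset.union_subset hs₁ hs₂⟩
    · rintro W hW ⟨F, hF, hFW⟩
      obtain ⟨F₁, h₁, F₂, h₂, rfl⟩ := Finset.mem_image₂.1 hF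
      simp only [Bool.and_eq_true]
      exact ⟨w₁.eval_of_accepts_approx hW ⟨F₁, h₁, Finset.subset_union_left.trans hFW⟩,
        w₂.eval_of_accepts_approx hW ⟨F₂, h₂, Finset.subset_union_right.trans hFW⟩⟩
  | @orGate m G w₁ w₂ ih =>
    obtain ⟨𝓐, h𝓐⟩ := ih
    have hw := fun w : Wire α m => w.card_le_of_mem_approx ha h𝓐.1
    have := h𝓐.snoc hstep (h := fun x => w₁.eval x (G.eval x) || w₂.eval x (G.eval x))
      (𝓕 := w₁.approx 𝓐 ∪ w₂.approx 𝓐) ?_ ?_ ?_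
    · simpa only [Nat.cast_add, Nat.cast_one, add_mul, one_mul, MonotoneGates.eval] using this
    · intro F hF
      have hac' : a ≤ c := by omega
      rcases Finset.mem_union.1 hF with h | h
      exacts [(hw w₁ _ h).trans hac', (hw w₂ _ h).trans hac']
    · intro W hW hval
      simp only [Bool.or_eq_true] at hval
      rcases hval with h | h
      · exact (w₁.accepts_approx_of_eval hW h).mono Finset.subset_union_left
      · exact (w₂.accepts_approx_of_eval hW h).mono Finset.subset_union_right
    · rintro W hW ⟨F, hF, hFW⟩
      simp only [Bool.or_eq_true]
      rcases Finset.mem_union.1 hF with h | h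
      · exact Or.inl (w₁.eval_of_accepts_approx hW ⟨F, h, hFW⟩)
      · exact Or.inr (w₂.eval_of_accepts_approx hW ⟨F, h, hFW⟩)

open Classical in
/-- A small circuit accepts few of the spread positive inputs, or it accepts a random set with
large probability. The alternative is decided by a closed family above the approximator of the
output: if the empty set is a member, every set is accepted; otherwise spreadness bounds the
positive inputs it accepts. -/
theorem MonotoneCircuit.accepts_few_or_many {B ε κ : ℝ}
    (hB : IsRobustSunflowerConstant B) (hε : 0 < ε) (hε2 : ε ≤ 1 / 2) {a c : ℕ} (ha : 1 ≤ a)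
    (hac : a + a ≤ c) {S : Ω → Finset α} (hκ : 0 ≤ κ) (hS : IsSpreadInput S κ c)
    (hκB : ∀ ℓ : ℕ, 1 ≤ ℓ → ℓ ≤ c → B * Real.log ((ℓ : ℝ) / ε) / (1 / 2) * κ ≤ 1 / 3)
    (C : MonotoneCircuit α) :
    (({v | C.eval (inputOf (S v)) = true} : Finset Ω).card : ℝ) ≤
        Fintype.card Ω * (1 / 2 + C.size * (1 / 2 * (1 / 3) ^ a)) ∨
      1 ≤ biasedProb (1 / 2) (fun W => C.eval (inputOf W) = true) +
        (C.size + 1) * (numSmall α c * ε) := by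
  obtain ⟨𝓐, hsize, hpos, hneg⟩ := C.gates.exists_approximates (S := S) ha hac
    (δ := Fintype.card Ω * (1 / 2 * (1 / 3) ^ a)) (η := numSmall α c * ε) (by
      intro 𝓕 h𝓕
      obtain ⟨𝓒, hsub, hsize, hclosed, herr⟩ := exists_isClosedFamily hε.le c 𝓕 h𝓕
      refine ⟨{F ∈ 𝓒 | F.card ≤ a}, fun F hF => (Finset.mem_filter.1 hF).2, ?_, ?_⟩
      · refine le_trans (Nat.cast_le.2 (Finset.card_le_card ?_))
          (card_accepts_not_accepts_le hB hε hε2 hsize hclosed hκ hS hκB a)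
        intro v hv
        simp only [Finset.mem_filter, Finset.mem_univ, true_and] at hv ⊢
        exact ⟨hv.1.mono hsub, hv.2⟩
      · refine le_trans (biasedProb_mono (by norm_num) (by norm_num) ?_) herr
        exact fun W hW => ⟨hW.1.mono (Finset.filter_subset _ _), hW.2⟩)
  have hac' : a ≤ c := by omega
  obtain ⟨𝓒, hsub, hsize𝓒, hclosed, herr⟩ := exists_isClosedFamily hε.le c (C.output.approx 𝓐)
    fun F hF => (C.output.card_le_of_mem_approx ha hsize F hF).trans hac'
  by_cases hempty : ∅ ∈ 𝓒
  · right
    have hall : biasedProb (1 / 2) (fun W : Finset α => C.eval (inputOf W) = true ∨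
        ((∃ j, Accepts (𝓐 j) W ∧ ¬ C.gates.eval (inputOf W) j = true) ∨
          (Accepts 𝓒 W ∧ ¬ Accepts (C.output.approx 𝓐) W))) = 1 := by
      refine biasedProb_eq_one fun W => ?_
      by_contra hno
      push Not at hno
      exact hno.1 (C.output.eval_of_accepts_approx hno.2.1
        (hno.2.2 ⟨∅, hempty, Finset.empty_subset W⟩))
    have h1 := biasedProb_or_le (p := 1 / 2) (by norm_num) (by norm_num)
      (fun W : Finset α => C.eval (inputOf W) = true)
      (fun W => (∃ j, Accepts (𝓐 j) W ∧ ¬ C.gates.eval (inputOf W) j = true) ∨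
          (Accepts 𝓒 W ∧ ¬ Accepts (C.output.approx 𝓐) W))
    have h2 := biasedProb_or_le (p := 1 / 2) (by norm_num) (by norm_num)
      (fun W => ∃ j, Accepts (𝓐 j) W ∧ ¬ C.gates.eval (inputOf W) j = true)
      (fun W => Accepts 𝓒 W ∧ ¬ Accepts (C.output.approx 𝓐) W)
    linarith
  · left
    have hfew := card_accepts_not_accepts_le hB hε hε2 hsize𝓒 hclosed hκ hS hκB 0
    have hcover : ({v | C.eval (inputOf (S v)) = true} : Finset Ω) ⊆
        ({v | Accepts 𝓒 (S v) ∧ ¬ Accepts {F ∈ 𝓒 | F.card ≤ 0} (S v)} : Finset Ω) ∪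
        ({v | ∃ j, C.gates.eval (inputOf (S v)) j = true ∧ ¬ Accepts (𝓐 j) (S v)} : Finset Ω) := by
      intro v hv
      simp only [Finset.mem_filter, Finset.mem_univ, true_and, Finset.mem_union] at hv ⊢
      by_contra hno
      push Not at hno
      obtain ⟨F, hF, -⟩ := hno.1 ((C.output.accepts_approx_of_eval hno.2 hv).mono hsub)
      rw [Finset.mem_filter, Nat.le_zero, Finset.card_eq_zero] at hF
      exact hempty (hF.2 ▸ hF.1)
    have h1 := Nat.cast_le (α := ℝ).2
      ((Finset.card_le_card hcover).trans (Finset.card_union_le _ _))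
    rw [Nat.cast_add] at h1
    rw [pow_zero, mul_one] at hfew
    linarith

end Gates

/-! ### Random polynomials over a prime field -/

section Polynomials

variable {n : ℕ} [Fact n.Prime] {c : ℕ}

/-- The polynomial of degree less than `c` with coefficient vector `v`. -/
noncomputable def polyOf (v : Fin c → ZMod n) : Polynomial (ZMod n) :=
  ((Polynomial.degreeLTEquiv (ZMod n) c).symm v : Polynomial.degreeLT (ZMod n) c)

theorem degree_polyOf_lt (v : Fin c → ZMod n) : (polyOf v).degree < (c : WithBot ℕ) :=
  Polynomial.mem_degreeLT.1 ((Polynomial.degreeLTEquiv (ZMod n) c).symm v).2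

theorem polyOf_injective : Function.Injective (polyOf : (Fin c → ZMod n) → _) := fun _ _ h =>
  (Polynomial.degreeLTEquiv (ZMod n) c).symm.injective (Subtype.ext h)

theorem exists_polyOf_eq {P : Polynomial (ZMod n)} (hP : P.degree < (c : WithBot ℕ)) :
    ∃ v : Fin c → ZMod n, polyOf v = P :=
  ⟨Polynomial.degreeLTEquiv (ZMod n) c ⟨P, Polynomial.mem_degreeLT.2 hP⟩, by simp [polyOf]⟩

/-- At most `n ^ (c - |J|)` polynomials of degree less than `c` take prescribed values at `|J|`
distinct points: the values at `c - |J|` further points determine the polynomial. -/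
theorem card_polyOf_eval_eq_le {J : Type} [Fintype J] (hc : c ≤ n) (hJ : Fintype.card J ≤ c)
    {x : J → ZMod n} (hx : Function.Injective x) (y : J → ZMod n) :
    ({v | ∀ j, (polyOf v).eval (x j) = y j} : Finset (Fin c → ZMod n)).card ≤
      n ^ (c - Fintype.card J) := by
  classical
  have hcard : (Finset.univ.image x).card = Fintype.card J := by
    rw [Finset.card_image_of_injective _ hx, Finset.card_univ]
  obtain ⟨T, hT, -, hTc⟩ := Finset.exists_subsuperset_card_eq (Finset.subset_univ
    (Finset.univ.image x)) (hcard.trans_le hJ) (by rwa [Finset.card_univ, ZMod.card])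
  let e : (Fin c → ZMod n) → ((T \ Finset.univ.image x : Finset (ZMod n)) → ZMod n) :=
    fun v t => (polyOf v).eval t.1
  have hcod : Fintype.card ((T \ Finset.univ.image x : Finset (ZMod n)) → ZMod n) =
      n ^ (c - Fintype.card J) := by
    rw [Fintype.card_fun, ZMod.card, Fintype.card_coe, Finset.card_sdiff_of_subset hT, hTc, hcard]
  rw [← hcod, ← Finset.card_univ]
  refine Finset.card_le_card_of_injOn e (fun _ _ => Finset.mem_coe.2 (Finset.mem_univ _)) ?_
  intro v hv w hw hvw
  simp only [Finset.coe_filter, Finset.mem_univ, true_and, Set.mem_ofPred_eq] at hv hw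
  refine polyOf_injective (Polynomial.eq_of_degrees_lt_of_eval_finset_eq T
    ((degree_polyOf_lt v).trans_eq (by rw [hTc])) ((degree_polyOf_lt w).trans_eq (by rw [hTc])) ?_)
  intro t ht
  by_cases h : t ∈ Finset.univ.image x
  · obtain ⟨j, -, rfl⟩ := Finset.mem_image.1 h
    rw [hv, hw]
  · exact congrFun hvw ⟨t, Finset.mem_sdiff.2 ⟨ht, h⟩⟩

/-- Every set `A` of size at most `c` lies in at most `k ^ |A| n ^ (c - |A|)` of the value sets:
choose for each element of `A` the argument at which it is taken. -/
theorem card_subset_valueSet_le (hc : c ≤ n) (k : ℕ) {A : Finset (ZMod n)} (hA : A.card ≤ c) :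
    ({v | A ⊆ valueSet n k (polyOf v)} : Finset (Fin c → ZMod n)).card ≤
      k ^ A.card * n ^ (c - A.card) := by
  classical
  let K := Finset.Icc 1 k
  have hcover : ({v | A ⊆ valueSet n k (polyOf v)} : Finset (Fin c → ZMod n)) ⊆
      (Finset.univ : Finset (A → K)).biUnion fun g =>
        {v | ∀ j : A, (polyOf v).eval ((g j : ℕ) : ZMod n) = j} := by
    intro v hv
    simp only [Finset.mem_filter, Finset.mem_univ, true_and] at hv
    have hex : ∀ j : A, ∃ i : K, (polyOf v).eval ((i : ℕ) : ZMod n) = j := by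
      intro j
      obtain ⟨i, hi, hij⟩ := Finset.mem_image.1 (hv j.2)
      exact ⟨⟨i, hi⟩, hij⟩
    choose g hg using hex
    simp only [Finset.mem_biUnion, Finset.mem_univ, true_and, Finset.mem_filter]
    exact ⟨g, hg⟩
  refine (Finset.card_le_card hcover).trans ?_
  refine (Finset.card_biUnion_le_card_mul _ _ (n ^ (c - A.card)) fun g _ => ?_).trans_eq ?_
  · by_cases hg : Function.Injective fun j : A => ((g j : ℕ) : ZMod n)
    · have := card_polyOf_eval_eq_le (J := A) hc (by rwa [Fintype.card_coe]) hg
        (fun j => (j : ZMod n))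
      rwa [Fintype.card_coe] at this
    · -- no polynomial takes distinct values at equal arguments
      have : ({v | ∀ j : A, (polyOf v).eval ((g j : ℕ) : ZMod n) = j} :
          Finset (Fin c → ZMod n)) = ∅ := by
        refine Finset.filter_eq_empty_iff.2 fun v _ hv => hg fun j j' hjj' => ?_
        refine Subtype.ext ?_
        rw [← hv j, ← hv j']
        exact congrArg (fun z => (polyOf v).eval z) hjj'
      rw [this, Finset.card_empty]
      exact Nat.zero_le _
  · rw [Finset.card_univ, Fintype.card_fun, Fintype.card_coe, Fintype.card_coe, Nat.card_Icc,
      Nat.add_sub_cancel]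

theorem isSpreadInput_valueSet (hc : c ≤ n) (k : ℕ) :
    IsSpreadInput (fun v : Fin c → ZMod n => valueSet n k (polyOf v)) ((k : ℝ) / n) c := by
  intro A hA
  have hn : (0 : ℝ) < n := by exact_mod_cast (Fact.out : n.Prime).pos
  rw [Fintype.card_fun, ZMod.card, Fintype.card_fin]
  have h := card_subset_valueSet_le hc k hA
  calc _ ≤ ((k ^ A.card * n ^ (c - A.card) : ℕ) : ℝ) := by exact_mod_cast h
    _ = _ := by
      push_cast
      rw [div_pow, show (n : ℝ) ^ c = n ^ A.card * n ^ (c - A.card) by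
        rw [← pow_add, Nat.add_sub_cancel' hA]]
      field_simp

theorem card_polyOf_eval_eq_eval_le (hc : c ≤ n) (hc2 : 2 ≤ c) {x y : ZMod n} (hxy : x ≠ y) :
    ({v | (polyOf v).eval x = (polyOf v).eval y} : Finset (Fin c → ZMod n)).card ≤
      n ^ (c - 1) := by
  classical
  have hcover : ({v | (polyOf v).eval x = (polyOf v).eval y} : Finset (Fin c → ZMod n)) ⊆
      (Finset.univ : Finset (ZMod n)).biUnion fun z =>
        {v | ∀ j : Fin 2, (polyOf v).eval (![x, y] j) = z} := by
    intro v hv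
    simp only [Finset.mem_filter, Finset.mem_univ, true_and] at hv
    simp only [Finset.mem_biUnion, Finset.mem_univ, true_and, Finset.mem_filter, Fin.forall_fin_two]
    exact ⟨_, rfl, hv.symm⟩
  have hinj : Function.Injective ![x, y] := by
    intro i j
    fin_cases i <;> fin_cases j <;> simp [hxy, hxy.symm]
  refine (Finset.card_le_card hcover).trans ?_
  refine (Finset.card_biUnion_le_card_mul _ _ (n ^ (c - 2)) fun z _ => ?_).trans_eq ?_
  · simpa using card_polyOf_eval_eq_le (J := Fin 2) hc (by simpa using hc2) hinj fun _ => z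
  · rw [Finset.card_univ, ZMod.card, ← pow_succ', show c - 2 + 1 = c - 1 by omega]

/-- A map with few values has many collisions. -/
theorem card_sub_card_image_le {β γ : Type} [DecidableEq β] [DecidableEq γ] (s : Finset β)
    (f : β → γ) : s.card - (s.image f).card ≤ {x ∈ s.offDiag | f x.1 = f x.2}.card := by
  obtain ⟨u, hus, hinj, himg⟩ := Finset.exists_subset_injOn_image_eq_of_surjOn s (s.image f)
    (f := f) (by rw [Finset.coe_image]; exact Set.surjOn_image f s)
  have hpartner : ∀ i, ∃ j, i ∈ s → j ∈ u ∧ f i = f j := by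
    intro i
    by_cases hi : i ∈ s
    · have := Finset.mem_image_of_mem f hi
      rw [← himg] at this
      obtain ⟨j, hj, hij⟩ := Finset.mem_image.1 this
      exact ⟨j, fun _ => ⟨hj, hij.symm⟩⟩
    · exact ⟨i, fun h => absurd h hi⟩
  choose g hg using hpartner
  have hus' : u ⊆ s := by exact_mod_cast hus
  rw [← himg, Finset.card_image_of_injOn hinj, ← Finset.card_sdiff_of_subset hus']
  refine Finset.card_le_card_of_injOn (fun i => (i, g i)) ?_ ?_
  · intro i hi
    simp only [Finset.coe_sdiff, Set.mem_sdiff, Finset.mem_coe] at hi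
    have := hg i hi.1
    simp only [Finset.coe_filter, Finset.mem_offDiag, Set.mem_ofPred_eq]
    exact ⟨⟨hi.1, hus' this.1, fun h => hi.2 (h ▸ this.1)⟩, this.2⟩
  · intro i _ j _ hij
    exact (Prod.ext_iff.1 hij).1

/-- Few value sets are smaller than `k / 2`: a random polynomial has in expectation at most
`k ^ 2 / n ≤ 1` collisions among its values at `1, …, k`. -/
theorem card_valueSet_small_mul_le (hc : c ≤ n) (hc2 : 2 ≤ c) {k : ℕ} (hk : k * k ≤ n)
    (hkn : k < n) :
    ({v | 2 * (valueSet n k (polyOf v)).card < k} : Finset (Fin c → ZMod n)).card * k ≤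
      2 * n ^ c := by
  classical
  let s := Finset.Icc 1 k
  let coll : (Fin c → ZMod n) → ℕ := fun v => {x ∈ s.offDiag |
    (polyOf v).eval (x.1 : ZMod n) = (polyOf v).eval (x.2 : ZMod n)}.card
  have hs : s.card = k := by simp [s]
  have hcoll : ∀ v ∈ ({v | 2 * (valueSet n k (polyOf v)).card < k} : Finset (Fin c → ZMod n)),
      k ≤ 2 * coll v := by
    intro v hv
    simp only [Finset.mem_filter, Finset.mem_univ, true_and] at hv
    have h := card_sub_card_image_le s fun i : ℕ => (polyOf v).eval (i : ZMod n)
    rw [hs] at h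
    change k - (valueSet n k (polyOf v)).card ≤ coll v at h
    omega
  have hcast : ∀ x ∈ s.offDiag, ((x.1 : ℕ) : ZMod n) ≠ ((x.2 : ℕ) : ZMod n) := by
    intro x hx h
    simp only [s, Finset.mem_offDiag, Finset.mem_Icc] at hx
    rw [ZMod.natCast_eq_natCast_iff] at h
    exact hx.2.2 (h.eq_of_lt_of_lt (by omega) (by omega))
  calc _ ≤ ∑ v ∈ ({v | 2 * (valueSet n k (polyOf v)).card < k} : Finset (Fin c → ZMod n)),
        2 * coll v := by
        rw [← smul_eq_mul]
        exact Finset.card_nsmul_le_sum _ _ _ hcoll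
    _ ≤ ∑ v, 2 * coll v := Finset.sum_le_sum_of_subset (Finset.subset_univ _)
    _ = 2 * ∑ x ∈ s.offDiag, ({v | (polyOf v).eval (x.1 : ZMod n) = (polyOf v).eval (x.2 : ZMod n)} :
          Finset (Fin c → ZMod n)).card := by
        rw [← Finset.mul_sum]
        simp only [coll, Finset.card_filter]
        rw [Finset.sum_comm]
    _ ≤ 2 * (s.offDiag.card * n ^ (c - 1)) := by
        refine Nat.mul_le_mul_left _ ?_
        rw [← smul_eq_mul]
        exact Finset.sum_le_card_nsmul _ _ _ fun x hx =>
          card_polyOf_eval_eq_eval_le hc hc2 (hcast x hx)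
    _ ≤ 2 * (n * n ^ (c - 1)) := by
        refine Nat.mul_le_mul_left _ (Nat.mul_le_mul_right _ ?_)
        rw [Finset.offDiag_card, hs]
        omega
    _ = 2 * n ^ c := by rw [← pow_succ', show c - 1 + 1 = c by omega]

/-- A uniformly random set satisfies the Harnik–Raz function with small probability. -/
theorem biasedProb_harnikRaz_le (k : ℕ) :
    biasedProb (1 / 2) (fun W : Finset (ZMod n) => harnikRaz n c k (inputOf W) = true) ≤
      n ^ c * (1 / 2 : ℝ) ^ ((k : ℝ) / 2) := by
  classical
  let good : Finset (Fin c → ZMod n) := {v | (k : ℝ) / 2 ≤ ((valueSet n k (polyOf v)).card : ℝ)}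
  have h1 : biasedProb (1 / 2) (fun W : Finset (ZMod n) => harnikRaz n c k (inputOf W) = true) ≤
      biasedProb (1 / 2) (fun W => ∃ v ∈ good, valueSet n k (polyOf v) ⊆ W) := by
    refine biasedProb_mono (by norm_num) (by norm_num) ?_
    intro W hW
    simp only [harnikRaz, familyDNF, inputOf, decide_eq_true_eq] at hW
    obtain ⟨S, ⟨P, hP, rfl, hcard⟩, hS⟩ := hW
    obtain ⟨v, rfl⟩ := exists_polyOf_eq hP
    exact ⟨v, by simp [good, hcard], fun j hj => hS j hj⟩
  refine h1.trans ((biasedProb_exists_le (by norm_num) (by norm_num) _ _).trans ?_)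
  have h2 : ∀ v ∈ good, biasedProb (1 / 2) (fun W => valueSet n k (polyOf v) ⊆ W) ≤
      (1 / 2 : ℝ) ^ ((k : ℝ) / 2) := by
    intro v hv
    rw [biasedProb_superset, ← Real.rpow_natCast]
    exact Real.rpow_le_rpow_of_exponent_ge (by norm_num) (by norm_num)
      (by simpa [good] using hv)
  refine (Finset.sum_le_card_nsmul _ _ _ h2).trans ?_
  rw [nsmul_eq_mul]
  refine mul_le_mul_of_nonneg_right ?_ (by positivity)
  have := Finset.card_le_univ good
  rw [Fintype.card_fun, ZMod.card, Fintype.card_fin] at this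
  exact_mod_cast this

theorem harnikRaz_inputOf_valueSet {k : ℕ} {v : Fin c → ZMod n}
    (hv : ¬ 2 * (valueSet n k (polyOf v)).card < k) :
    harnikRaz n c k (inputOf (valueSet n k (polyOf v))) = true := by
  have h2 : (k : ℝ) ≤ 2 * ((valueSet n k (polyOf v)).card : ℝ) := by exact_mod_cast not_lt.1 hv
  have hmem : valueSet n k (polyOf v) ∈ harnikRazFamily n c k :=
    ⟨polyOf v, degree_polyOf_lt v, rfl, by linarith⟩
  simp only [harnikRaz, familyDNF, decide_eq_true_eq]
  exact ⟨_, hmem, fun j hj => decide_eq_true hj⟩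

/-- There are at most `2 n ^ c` sets of size at most `c`. -/
theorem numSmall_le : numSmall (ZMod n) c ≤ 2 * n ^ c := by
  classical
  have hn2 : 2 ≤ n := (Fact.out : n.Prime).two_le
  have hcover : ({A | A.card ≤ c} : Finset (Finset (ZMod n))) ⊆
      (Finset.range (c + 1)).biUnion fun i => Finset.powersetCard i Finset.univ := by
    intro A hA
    simp only [Finset.mem_filter, Finset.mem_univ, true_and] at hA
    simp only [Finset.mem_biUnion, Finset.mem_range, Finset.mem_powersetCard]
    exact ⟨A.card, by omega, Finset.subset_univ _, rfl⟩
  calc _ ≤ ∑ i ∈ Finset.range (c + 1), n ^ i := by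
        refine ((Finset.card_le_card hcover).trans Finset.card_biUnion_le).trans ?_
        refine Finset.sum_le_sum fun i _ => ?_
        rw [Finset.card_powersetCard, Finset.card_univ, ZMod.card]
        exact Nat.choose_le_pow n i
    _ ≤ 2 * n ^ c := by
        clear hcover
        induction c with
        | zero => simp
        | succ c ih =>
          rw [Finset.sum_range_succ]
          have := Nat.mul_le_mul_left (n ^ c) hn2
          rw [pow_succ]
          omega

end Polynomials

/-! ### The choice of parameters -/

section Parameters

theorem eventually_hrK_large {B : ℝ} (hB : 0 < B) :
    ∃ N : ℕ, ∀ n : ℕ, N ≤ n → 64 ≤ n ∧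
      4 ≤ (hrK n : ℝ) / (18 * B * Real.log n) ∧ Real.sqrt n ≤ 2 * hrK n := by
  have h := ((isLittleO_log_rpow_atTop (r := 1 / 2) (by norm_num)).bound
    (c := 1 / (144 * B)) (by positivity)).natCast_atTop
  obtain ⟨N, hN⟩ := Filter.eventually_atTop.1 h
  refine ⟨max N 64, fun n hn => ?_⟩
  have hn64 : 64 ≤ n := (le_max_right _ _).trans hn
  have hlog := hN n ((le_max_left _ _).trans hn)
  have hn1 : (1 : ℝ) < n := by exact_mod_cast (by omega : 1 < n)
  have hlogpos : 0 < Real.log n := Real.log_pos hn1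
  rw [← Real.sqrt_eq_rpow, Real.norm_of_nonneg hlogpos.le,
    Real.norm_of_nonneg (Real.sqrt_nonneg _)] at hlog
  have hk1 : 1 ≤ hrK n := Nat.le_sqrt.2 (by omega)
  have hsqrt : Real.sqrt n ≤ hrK n + 1 := by
    rw [hrK]
    refine Real.sqrt_le_iff.2 ⟨by positivity, ?_⟩
    have := (Nat.lt_succ_sqrt' n).le
    exact_mod_cast this
  have hk1' : (1 : ℝ) ≤ hrK n := by exact_mod_cast hk1
  have hsk : Real.sqrt n ≤ 2 * hrK n := by linarith
  refine ⟨hn64, ?_, hsk⟩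
  rw [le_div_iff₀ (by positivity)]
  rw [div_mul_eq_mul_div, one_mul, le_div_iff₀ (by positivity)] at hlog
  linarith

/-- With `k = ⌊√n⌋`, `c = ⌊k / (18 B log n)⌋`, `p = 1/2` and `ε = n ^ (-2 c)`, one has
`2 B log(ℓ/ε) ≤ 6 B c log n ≤ k / 3` for `ℓ ≤ c`. So a closed family has at most `(k / 3) ^ ℓ`
minimal members of size `ℓ`, each in a `(k / n) ^ ℓ` fraction of the positive inputs, and since
`k ^ 2 ≤ n` together they cover at most a `3 ^ (-ℓ)` fraction. -/
theorem two_rpow_le_size {B : ℝ} (hB : IsRobustSunflowerConstant B) {n : ℕ} (hn : n.Prime)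
    (hn64 : 64 ≤ n) (hx : 4 ≤ (hrK n : ℝ) / (18 * B * Real.log n)) (C : MonotoneCircuit (ZMod n))
    (hC : C.Computes (harnikRaz n (hrC B n) (hrK n))) :
    (2 : ℝ) ^ ((hrC B n : ℝ) / 8) ≤ C.size := by
  classical
  have : Fact n.Prime := ⟨hn⟩
  set k := hrK n with hk
  set c := hrC B n with hc
  have hB0 := hB.1
  have hBlog := hB.one_lt
  have hn1 : (1 : ℝ) < n := by exact_mod_cast hn.one_lt
  have hn0 : (0 : ℝ) < n := by linarith
  have hlog0 : 0 < Real.log n := Real.log_pos hn1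
  have hlog2 : Real.log 2 ≤ Real.log n :=
    Real.log_le_log (by norm_num) (by exact_mod_cast hn.two_le)
  have hk8 : 8 ≤ k := Nat.le_sqrt.2 (by omega)
  have hk8' : (8 : ℝ) ≤ k := by exact_mod_cast hk8
  have hkk : k * k ≤ n := Nat.sqrt_le n
  have hkn : k < n := Nat.sqrt_lt_self hn.one_lt
  have hcle : (c : ℝ) * (18 * B * Real.log n) ≤ k := by
    rw [← le_div_iff₀ (by positivity)]
    exact Nat.floor_le (by linarith)
  have hc4 : 4 ≤ c := Nat.le_floor (by exact_mod_cast hx)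
  have hc4' : (4 : ℝ) ≤ c := by exact_mod_cast hc4
  have hck : c ≤ k := by
    have h1 : 1 ≤ 18 * B * Real.log n := by nlinarith
    have : (c : ℝ) ≤ k := le_trans (le_mul_of_one_le_right (by positivity) h1) hcle
    exact_mod_cast this
  have hcn : c ≤ n := hck.trans hkn.le
  have hnc : (0 : ℝ) < (n : ℝ) ^ c := by positivity
  have hncbig : (256 : ℝ) * 2 ^ c ≤ (n : ℝ) ^ c := by
    calc (256 : ℝ) * 2 ^ c = 4 ^ 4 * 2 ^ c := by norm_num
      _ ≤ 4 ^ c * 2 ^ c := mul_le_mul_of_nonneg_right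
          (pow_le_pow_right₀ (by norm_num) hc4) (by positivity)
      _ = 8 ^ c := by rw [← mul_pow]; norm_num
      _ ≤ (n : ℝ) ^ c := pow_le_pow_left₀ (by norm_num)
          (by exact_mod_cast (by omega : 8 ≤ n)) _
  have h2c : (1 : ℝ) ≤ 2 ^ c := one_le_pow₀ (by norm_num)
  set ε : ℝ := (((n : ℝ) ^ c) ^ 2)⁻¹ with hε
  have hε0 : 0 < ε := by positivity
  have hε2 : ε ≤ 1 / 2 := by
    rw [hε, one_div]
    exact inv_anti₀ (by norm_num) (by nlinarith)
  set a := c / 2 with ha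
  have hκB : ∀ ℓ : ℕ, 1 ≤ ℓ → ℓ ≤ c →
      B * Real.log ((ℓ : ℝ) / ε) / (1 / 2) * ((k : ℝ) / n) ≤ 1 / 3 := by
    intro ℓ hℓ hℓc
    have hℓ0 : (0 : ℝ) < ℓ := by exact_mod_cast hℓ
    have hℓn : Real.log ℓ ≤ Real.log n :=
      Real.log_le_log hℓ0 (by exact_mod_cast hℓc.trans hcn)
    have hlog : Real.log ((ℓ : ℝ) / ε) ≤ 3 * c * Real.log n := by
      rw [hε, div_inv_eq_mul, Real.log_mul hℓ0.ne' (by positivity), Real.log_pow, Real.log_pow]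
      push_cast
      nlinarith
    have hkn' : (k : ℝ) * k ≤ n := by exact_mod_cast hkk
    calc B * Real.log ((ℓ : ℝ) / ε) / (1 / 2) * ((k : ℝ) / n)
        ≤ B * (3 * c * Real.log n) / (1 / 2) * ((k : ℝ) / n) := by gcongr
      _ = 1 / 3 * (c * (18 * B * Real.log n)) * (k / n) := by ring
      _ ≤ 1 / 3 * k * (k / n) := by gcongr
      _ = 1 / 3 * (k * k / n) := by ring
      _ ≤ 1 / 3 * 1 := by
          have : (k : ℝ) * k / n ≤ 1 := (div_le_one hn0).2 hkn'
          linarith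
      _ = 1 / 3 := by ring
  rcases C.accepts_few_or_many hB hε0 hε2 (a := a) (by omega) (by omega)
    (κ := (k : ℝ) / n) (by positivity) (isSpreadInput_valueSet hcn k) hκB with hfew | hmany
  · -- most value sets are large, hence accepted
    rw [Fintype.card_fun, ZMod.card, Fintype.card_fin, Nat.cast_pow] at hfew
    have hsmall := card_valueSet_small_mul_le hcn (by omega : 2 ≤ c) hkk hkn
    have hsplit := Finset.card_filter_add_card_filter_not
      (s := (Finset.univ : Finset (Fin c → ZMod n)))
      (fun v => 2 * (valueSet n k (polyOf v)).card < k)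
    rw [Finset.card_univ, Fintype.card_fun, ZMod.card, Fintype.card_fin] at hsplit
    have hsub : ({v | ¬ 2 * (valueSet n k (polyOf v)).card < k} : Finset (Fin c → ZMod n)) ⊆
        ({v | C.eval (inputOf (valueSet n k (polyOf v))) = true} : Finset _) := by
      intro v hv
      simp only [Finset.mem_filter, Finset.mem_univ, true_and] at hv ⊢
      rw [hC]
      exact harnikRaz_inputOf_valueSet hv
    have hle := Nat.cast_le (α := ℝ).2 (Finset.card_le_card hsub)
    have hsplit' : (({v | 2 * (valueSet n k (polyOf v)).card < k} :
        Finset (Fin c → ZMod n)).card : ℝ) + (({v | ¬ 2 * (valueSet n k (polyOf v)).card < k} :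
        Finset (Fin c → ZMod n)).card : ℝ) = (n : ℝ) ^ c := by exact_mod_cast hsplit
    have hsmall' : (({v | 2 * (valueSet n k (polyOf v)).card < k} :
        Finset (Fin c → ZMod n)).card : ℝ) * k ≤ 2 * (n : ℝ) ^ c := by exact_mod_cast hsmall
    have hquarter : (({v | 2 * (valueSet n k (polyOf v)).card < k} :
        Finset (Fin c → ZMod n)).card : ℝ) ≤ 1 / 4 * (n : ℝ) ^ c := by
      have := mul_le_mul_of_nonneg_left hk8' (Nat.cast_nonneg (α := ℝ)
        ({v | 2 * (valueSet n k (polyOf v)).card < k} : Finset (Fin c → ZMod n)).card)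
      linarith
    have hhalf : 3 / 4 ≤ 1 / 2 + C.size * (1 / 2 * (1 / 3 : ℝ) ^ a) := by
      refine le_of_mul_le_mul_left (le_trans ?_ (hle.trans (le_of_eq_of_le ?_ hfew))) hnc
      · linarith
      · rfl
    have hthree : (3 : ℝ) ^ a ≤ 2 * C.size := by
      have h3 : (1 / 3 : ℝ) ^ a * 3 ^ a = 1 := by rw [← mul_pow]; norm_num
      have h4 : 1 ≤ 2 * C.size * (1 / 3 : ℝ) ^ a := by linarith
      have := mul_le_mul_of_nonneg_right h4 (by positivity : (0 : ℝ) ≤ 3 ^ a)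
      rw [mul_assoc, h3] at this
      linarith
    have htwo : (2 : ℝ) ^ (a - 1) * 2 ≤ 3 ^ a := by
      rw [← pow_succ, show a - 1 + 1 = a by omega]
      exact pow_le_pow_left₀ (by norm_num) (by norm_num) _
    have hexp : (c : ℝ) / 8 ≤ ((a - 1 : ℕ) : ℝ) := by
      have : c ≤ 8 * (a - 1) := by omega
      have : (c : ℝ) ≤ 8 * ((a - 1 : ℕ) : ℝ) := by exact_mod_cast this
      linarith
    calc (2 : ℝ) ^ ((c : ℝ) / 8) ≤ 2 ^ ((a - 1 : ℕ) : ℝ) :=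
          Real.rpow_le_rpow_of_exponent_le (by norm_num) hexp
      _ = 2 ^ (a - 1) := Real.rpow_natCast _ _
      _ ≤ C.size := by linarith
  · -- a random set is accepted with probability at most `1 / 2`
    have hprob : biasedProb (1 / 2) (fun W => C.eval (inputOf W) = true) ≤ 1 / 2 := by
      have h1 := biasedProb_harnikRaz_le (n := n) (c := c) k
      have heq : (fun W : Finset (ZMod n) => C.eval (inputOf W) = true) =
          fun W => harnikRaz n c k (inputOf W) = true := by
        funext W
        rw [hC]
      rw [heq]
      refine h1.trans ?_
      have hl : (c : ℝ) * Real.log n ≤ k / 9 * Real.log 2 := by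
        have h2 : (c : ℝ) * Real.log n * (18 * B) ≤ k / 9 * Real.log 2 * (18 * B) := by
          nlinarith
        exact le_of_mul_le_mul_right h2 (by positivity)
      have hl2 : 0 < Real.log 2 := Real.log_pos (by norm_num)
      calc (n : ℝ) ^ c * (1 / 2 : ℝ) ^ ((k : ℝ) / 2)
          = Real.exp (c * Real.log n + -(k / 2 * Real.log 2)) := by
            rw [Real.exp_add, Real.exp_nat_mul, Real.exp_log hn0,
              Real.rpow_def_of_pos (by norm_num), one_div, Real.log_inv]
            ring_nf
        _ ≤ Real.exp (-Real.log 2) := Real.exp_le_exp.2 (by nlinarith)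
        _ = 1 / 2 := by rw [Real.exp_neg, Real.exp_log (by norm_num), one_div]
    have hnum : (numSmall (ZMod n) c : ℝ) ≤ 2 * (n : ℝ) ^ c := by
      exact_mod_cast numSmall_le (n := n) (c := c)
    have herr : (numSmall (ZMod n) c : ℝ) * ε ≤ 2 / (n : ℝ) ^ c := by
      calc (numSmall (ZMod n) c : ℝ) * ε ≤ 2 * (n : ℝ) ^ c * ε :=
            mul_le_mul_of_nonneg_right hnum hε0.le
        _ = _ := by rw [hε]; field_simp
    have hs0 : (0 : ℝ) ≤ C.size + 1 := by positivity
    have h3 : 1 / 2 ≤ ((C.size : ℝ) + 1) * (2 / (n : ℝ) ^ c) := by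
      have := mul_le_mul_of_nonneg_left herr hs0
      linarith
    rw [mul_div_assoc', le_div_iff₀ hnc] at h3
    calc (2 : ℝ) ^ ((c : ℝ) / 8) ≤ 2 ^ (c : ℝ) :=
          Real.rpow_le_rpow_of_exponent_le (by norm_num) (by linarith)
      _ = 2 ^ c := Real.rpow_natCast _ _
      _ ≤ C.size := by linarith

end Parameters

theorem theorem2p19 :
    (∃ B : ℝ, IsRobustSunflowerConstant B) ∧
    ∀ B : ℝ, IsRobustSunflowerConstant B →
      ∃ δ : ℝ, 0 < δ ∧ ∃ N : ℕ, ∀ n : ℕ, N ≤ n → n.Prime →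
        ∀ C : MonotoneCircuit (ZMod n),
          C.Computes (harnikRaz n (hrC B n) (hrK n)) →
            (2 : ℝ) ^ (δ * (hrC B n : ℝ)) ≤ (C.size : ℝ) ∧
            (2 : ℝ) ^ (δ * (Real.sqrt n / Real.log n)) ≤ (C.size : ℝ) := by
  refine ⟨⟨_, isRobustSunflowerConstant_1536⟩, fun B hB => ?_⟩
  have hB0 := hB.1
  obtain ⟨N, hN⟩ := eventually_hrK_large hB0
  refine ⟨min (1 / 8) (1 / (576 * B)), lt_min (by norm_num) (by positivity), N, ?_⟩
  intro n hn hprime C hC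
  obtain ⟨hn64, hx, hsqrt⟩ := hN n hn
  have hsize := two_rpow_le_size hB hprime hn64 hx C hC
  have hlog0 : 0 < Real.log n := Real.log_pos (by exact_mod_cast hprime.one_lt)
  refine ⟨le_trans (Real.rpow_le_rpow_of_exponent_le (by norm_num) ?_) hsize,
    le_trans (Real.rpow_le_rpow_of_exponent_le (by norm_num) ?_) hsize⟩
  · have := mul_le_mul_of_nonneg_right (min_le_left (1 / 8 : ℝ) (1 / (576 * B)))
      (Nat.cast_nonneg (α := ℝ) (hrC B n))
    linarith
  · have hfloor : (hrK n : ℝ) / (18 * B * Real.log n) < hrC B n + 1 := Nat.lt_floor_add_one _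
    calc min (1 / 8) (1 / (576 * B)) * (Real.sqrt n / Real.log n)
        ≤ 1 / (576 * B) * (2 * hrK n / Real.log n) := by
          gcongr
          exact min_le_right _ _
      _ = (hrK n : ℝ) / (18 * B * Real.log n) / 16 := by field_simp; ring
      _ ≤ (hrC B n : ℝ) / 8 := by linarith
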